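/- Let $d\ge 2$, let $\Omega\subset\mathbb R^d$ be an open, bounded, convex domain with smooth boundary and unit outer normal $n$, and let $T>\operatorname{diam}\Omega$. Write $S\Omega=\Omega\times\mathbb S^{d-1}$, $S\Omega^2=\Omega\times\mathbb S^{d-1}\times\mathbb S^{d-1}$, $S\Omega_T=(0,T)\times S\Omega$, $\partial_\pm S\Omega=\{(x,v)\in\partial\Omega\times\mathbb S^{d-1}:\pm\langle n(x),v\rangle>0\}$, $\partial_\pm S\Omega_T=(0,T)\times\partial_\pm S\Omega$, and let $d\omega$ be the normalized surface measure on $\mathbb S^{d-1}$. Equalities and inequalities between functions in $L^\infty$ are meant almost everywhere. Let $\sigma_1,\sigma_2\in L^\infty(S\Omega)$ and $\mu=\mu(x,v',v)\in L^\infty(S\Omega^2)$ be nonnegative and such that, for $j=1,2$, $$\int_{\mathbb S^{d-1}}\mu(x,v,v')\,d\omega(v')\le\sigma_j(x,v),\qquad \int_{\mathbb S^{d-1}}\mu(x,v',v)\,d\omega(v')\le\sigma_j(x,v).$$ Let $N_1,N_2:S\Omega\times\mathbb R\to\mathbb R$ be such that $z\mapsto N_j(\cdot,\cdot,z)$ is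 a real-analytic map from $\mathbb R$ to $L^\infty(S\Omega)$ (near each $z_0\in\mathbb R$ it is the sum of a power series in $z-z_0$ with coefficients in $L^\infty(S\Omega)$, converging in $L^\infty(S\Omega)$ and, for almost every $(x,v)$, to $N_j(x,v,z)$ for all $z$ near $z_0$) and $N_j(x,v,0)=\partial_zN_j(x,v,0)=0$. Put $q_j^{(k)}(x,v)=\partial_z^kN_j(x,v,0)$, $k\ge2$, so that $N_j(x,v,z)=\sum_{k\ge2}q_j^{(k)}(x,v)z^k/k!$ for $z$ near $0$. Fix $\gamma\in\mathbb S^{d-1}$ and $\gamma_0>0$, and let $\Lambda$ be the class of functions $p$ on $S\Omega$ with $p(x,v)=p(x,-v)$ in $S\Omega$ and $p(x,v)=0$ whenever $|\gamma\cdot v|\le\gamma_0$. Suppose that $\sigma_j$, $\mu(\cdot,\cdot,v)$ (for almost every $v$) and $q_j^{(k)}$ (for all $k\ge2$) are in $\Lambda$, for $j=1,2$. For $(f_0,f_-)\in L^\infty(S\Omega)\times L^\infty(\partial_-S\Omega_T)$ let $\mathcal A_{\sigma,\mu,N}(f_0,f_-)=f|_{\partial_+S\Omega_T}$, where $f\in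 L^\infty(S\Omega_T)$ is the solution, when it exists (as it does for all sufficiently small data), of $$\partial_tf+v\cdot\nabla_xf+\sigma f+N(x,v,f)=\int_{\mathbb S^{d-1}}\mu(x,v',v)f(t,x,v')\,d\omega(v')\ \text{ in }S\Omega_T,\qquad f|_{t=0}=f_0,\qquad f|_{\partial_-S\Omega_T}=f_-.$$ Here $(\partial_t+v\cdot\nabla_x)f$ is the derivative of $f$ along the characteristics $s\mapsto(t+s,x+sv,v)$, along almost every one of which $f$ is absolutely continuous, and initial values and boundary values are limits along characteristics. Suppose that for some $\delta>0$ $$\mathcal A_{\sigma_1,\mu,N_1}(h,0)=\mathcal A_{\sigma_2,\mu,N_2}(h,0)$$ for every $h\in L^\infty(S\Omega)$ with $\|h\|_{L^\infty(S\Omega)}\le\delta$ for which both sides are defined. Then $\sigma_1=\sigma_2$ in $S\Omega$ and $N_1=N_2$ in $S\Omega\times\mathbb R$ (that is, for almost every $(x,v)\in S\Omega$, $N_1(x,v,z)=N_2(x,v,z)$ for all $z\in\mathbb R$). -/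

import Mathlib

open MeasureTheory Set Filter Topology
open scoped ENNReal ContDiff RealInnerProductSpace

noncomputable section

namespace Transport

/-- Position space `ℝ^d`. -/
abbrev Pos (d : ℕ) : Type := EuclideanSpace ℝ (Fin d)

/-- The unit sphere `𝕊^{d-1}` of directions. -/
abbrev Dir (d : ℕ) : Type := Metric.sphere (0 : Pos d) 1

/-- The normalized surface measure `dω` on the unit sphere (of total mass one). -/
def sphereMeasure (d : ℕ) : Measure (Dir d) :=
  ((volume : Measure (Pos d)).toSphere univ)⁻¹ • (volume : Measure (Pos d)).toSphere

variable {d : ℕ}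

/-- The measure `dx dω(v)` on the phase space `SΩ = Ω × 𝕊^{d-1}`. -/
def phaseMeasure (Ω : Set (Pos d)) : Measure (Pos d × Dir d) :=
  ((volume : Measure (Pos d)).restrict Ω).prod (sphereMeasure d)

/-- The measure `dx dω(v') dω(v)` on `SΩ² = Ω × 𝕊^{d-1} × 𝕊^{d-1}`. -/
def phaseMeasure₂ (Ω : Set (Pos d)) : Measure (Pos d × Dir d × Dir d) :=
  ((volume : Measure (Pos d)).restrict Ω).prod ((sphereMeasure d).prod (sphereMeasure d))

/-- The measure `dt dx dω(v)` on `SΩ_T = (0,T) × SΩ`. -/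
def timePhaseMeasure (Ω : Set (Pos d)) (T : ℝ) : Measure (ℝ × Pos d × Dir d) :=
  ((volume : Measure ℝ).restrict (Ioo 0 T)).prod (phaseMeasure Ω)

/-- The measure `dt dλ(y) dω(v)` on `(0,T) × ∂Ω × 𝕊^{d-1}`, where `λ` is the surface measure,
that is the `(d-1)`-dimensional Hausdorff measure on `∂Ω`. -/
def boundaryMeasure (Ω : Set (Pos d)) (T : ℝ) : Measure (ℝ × Pos d × Dir d) :=
  ((volume : Measure ℝ).restrict (Ioo 0 T)).prod
    (((Measure.hausdorffMeasure ((d : ℝ) - 1)).restrict (frontier Ω)).prod (sphereMeasure d))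

/-- `ρ` is a smooth defining function of `Ω` in the open neighbourhood `U` of `y`. -/
structure IsLocalDefiningFunction (Ω : Set (Pos d)) (y : Pos d) (U : Set (Pos d))
    (ρ : Pos d → ℝ) : Prop where
  isOpen : IsOpen U
  mem : y ∈ U
  smooth : ContDiffOn ℝ ∞ ρ U
  gradient_ne_zero : gradient ρ y ≠ 0
  inter_eq : Ω ∩ U = {z ∈ U | ρ z < 0}

/-- The boundary of the open set `Ω` is smooth: near each of its points, `Ω` is the sublevel set of
a smooth function with nonvanishing gradient. -/
def HasSmoothBoundary (Ω : Set (Pos d)) : Prop :=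
  ∀ y ∈ frontier Ω, ∃ U ρ, IsLocalDefiningFunction Ω y U ρ

/-- `n` is the unit outer normal vector of `Ω` at `y ∈ ∂Ω`. -/
def IsOuterUnitNormal (Ω : Set (Pos d)) (y n : Pos d) : Prop :=
  ∃ U ρ, IsLocalDefiningFunction Ω y U ρ ∧ n = ‖gradient ρ y‖⁻¹ • gradient ρ y

/-- The outgoing boundary `∂₊SΩ`. -/
def outgoing (Ω : Set (Pos d)) : Set (Pos d × Dir d) :=
  {p | p.1 ∈ frontier Ω ∧ ∃ n, IsOuterUnitNormal Ω p.1 n ∧ 0 < ⟪n, (p.2 : Pos d)⟫}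

/-- The incoming boundary `∂₋SΩ`. -/
def incoming (Ω : Set (Pos d)) : Set (Pos d × Dir d) :=
  {p | p.1 ∈ frontier Ω ∧ ∃ n, IsOuterUnitNormal Ω p.1 n ∧ ⟪n, (p.2 : Pos d)⟫ < 0}

/-- `σ ∈ L^∞(SΩ)` and `μ ∈ L^∞(SΩ²)` are nonnegative, and absorption dominates scattering. The
arguments of `μ` are `(x, v', v)`, where `v'` is the direction before scattering and `v` the one
after it. -/
structure IsAdmissible (Ω : Set (Pos d)) (σ : Pos d → Dir d → ℝ)
    (μ : Pos d → Dir d → Dir d → ℝ) : Prop where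
  memLp_absorption : MemLp (fun p : Pos d × Dir d => σ p.1 p.2) ∞ (phaseMeasure Ω)
  memLp_scattering :
    MemLp (fun p : Pos d × Dir d × Dir d => μ p.1 p.2.1 p.2.2) ∞ (phaseMeasure₂ Ω)
  absorption_nonneg : ∀ᵐ p ∂(phaseMeasure Ω), 0 ≤ σ p.1 p.2
  scattering_nonneg : ∀ᵐ p ∂(phaseMeasure₂ Ω), 0 ≤ μ p.1 p.2.1 p.2.2
  outflow_le : ∀ᵐ p ∂(phaseMeasure Ω), ∫ v', μ p.1 p.2 v' ∂(sphereMeasure d) ≤ σ p.1 p.2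
  inflow_le : ∀ᵐ p ∂(phaseMeasure Ω), ∫ v', μ p.1 v' p.2 ∂(sphereMeasure d) ≤ σ p.1 p.2

/-- The map `z ↦ N(·,·,z)` is (real) analytic from `ℝ` to `L^∞(SΩ)`: around each `z₀` it has a power
series expansion with coefficients in `L^∞(SΩ)` and positive radius of convergence. -/
def IsLinftyAnalytic (Ω : Set (Pos d)) (N : Pos d → Dir d → ℝ → ℝ) : Prop :=
  ∀ z₀ : ℝ, ∃ r : ℝ, 0 < r ∧ ∃ a : ℕ → Pos d → Dir d → ℝ,
    (∀ k, MemLp (fun p : Pos d × Dir d => a k p.1 p.2) ∞ (phaseMeasure Ω)) ∧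
    (Summable fun k =>
      (eLpNorm (fun p : Pos d × Dir d => a k p.1 p.2) ∞ (phaseMeasure Ω)).toReal * r ^ k) ∧
    ∀ᵐ p ∂(phaseMeasure Ω), ∀ z : ℝ, |z - z₀| < r →
      HasSum (fun k => a k p.1 p.2 * (z - z₀) ^ k) (N p.1 p.2 z)

/-- The nonlinearity is analytic in `z` and vanishes to second order at `z = 0`. -/
structure IsNonlinearity (Ω : Set (Pos d)) (N : Pos d → Dir d → ℝ → ℝ) : Prop where
  analytic : IsLinftyAnalytic Ω N
  zero : ∀ᵐ p ∂(phaseMeasure Ω), N p.1 p.2 0 = 0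
  deriv_zero : ∀ᵐ p ∂(phaseMeasure Ω), deriv (N p.1 p.2) 0 = 0

/-- The Taylor coefficient `q^{(k)}(x,v) = ∂_z^k N(x,v,0)`. -/
def taylorCoeff (N : Pos d → Dir d → ℝ → ℝ) (k : ℕ) : Pos d → Dir d → ℝ :=
  fun x v => iteratedDeriv k (N x v) 0

/-- The class `Λ` for the direction `γ` and the constant `γ₀`: `p` is even in the direction and
vanishes where `|γ · v| ≤ γ₀` (almost everywhere in `SΩ`). -/
def InLambda (Ω : Set (Pos d)) (γ : Dir d) (γ₀ : ℝ) (p : Pos d → Dir d → ℝ) : Prop :=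
  (∀ᵐ w ∂(phaseMeasure Ω), p w.1 w.2 = p w.1 (-w.2)) ∧
  (∀ᵐ w ∂(phaseMeasure Ω), |⟪(γ : Pos d), (w.2 : Pos d)⟫| ≤ γ₀ → p w.1 w.2 = 0)

/-- The scattering operator `K(f)(t,x,v) = ∫ μ(x,v',v) f(t,x,v') dω(v')`. -/
def scattering (μ : Pos d → Dir d → Dir d → ℝ) (f : ℝ → Pos d → Dir d → ℝ)
    (t : ℝ) (x : Pos d) (v : Dir d) : ℝ :=
  ∫ v', μ x v' v * f t x v' ∂(sphereMeasure d)

/-- The value `K(f) - σ f - N(x,v,f)` that the equation prescribes for `∂_t f + v · ∇_x f`. -/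
def transportRHS (σ : Pos d → Dir d → ℝ) (μ : Pos d → Dir d → Dir d → ℝ)
    (N : Pos d → Dir d → ℝ → ℝ) (f : ℝ → Pos d → Dir d → ℝ)
    (t : ℝ) (x : Pos d) (v : Dir d) : ℝ :=
  scattering μ f t x v - σ x v * f t x v - N x v (f t x v)

/-- `f ∈ L^∞(SΩ_T)` solves
`∂_t f + v · ∇_x f + σ f + N(x,v,f) = K(f)` in `SΩ_T`, `f = f₀` on `{0} × SΩ`,
`f = fm` on `∂₋SΩ_T`.

The operator `∂_t + v · ∇_x` is the derivative along the characteristics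
`s ↦ (t + s, x + s v, v)`. The equation says that along almost every characteristic `f` is
absolutely continuous with the prescribed derivative, and the initial and boundary values are
the limits of `f` along characteristics. The function `f` is the representative of its class in
`L^∞(SΩ_T)` for which this makes sense. -/
structure IsSolution (Ω : Set (Pos d)) (T : ℝ) (σ : Pos d → Dir d → ℝ)
    (μ : Pos d → Dir d → Dir d → ℝ) (N : Pos d → Dir d → ℝ → ℝ)
    (f₀ : Pos d → Dir d → ℝ) (fm : ℝ → Pos d → Dir d → ℝ)
    (f : ℝ → Pos d → Dir d → ℝ) : Prop where
  memLp : MemLp (fun w : ℝ × Pos d × Dir d => f w.1 w.2.1 w.2.2) ∞ (timePhaseMeasure Ω T)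
  equation : ∀ᵐ w ∂(timePhaseMeasure Ω T), ∀ s : ℝ,
    w.1 + s ∈ Ioo 0 T → w.2.1 + s • (w.2.2 : Pos d) ∈ Ω →
      IntervalIntegrable
        (fun r => transportRHS σ μ N f (w.1 + r) (w.2.1 + r • (w.2.2 : Pos d)) w.2.2) volume 0 s ∧
      f (w.1 + s) (w.2.1 + s • (w.2.2 : Pos d)) w.2.2 = f w.1 w.2.1 w.2.2 +
        ∫ r in (0 : ℝ)..s,
          transportRHS σ μ N f (w.1 + r) (w.2.1 + r • (w.2.2 : Pos d)) w.2.2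
  initial : ∀ᵐ p ∂(phaseMeasure Ω),
    Tendsto (fun s : ℝ => f s (p.1 + s • (p.2 : Pos d)) p.2) (𝓝[>] 0) (𝓝 (f₀ p.1 p.2))
  boundary : ∀ᵐ w ∂(boundaryMeasure Ω T), w.2 ∈ incoming Ω →
    Tendsto (fun s : ℝ => f (w.1 + s) (w.2.1 + s • (w.2.2 : Pos d)) w.2.2) (𝓝[>] 0)
      (𝓝 (fm w.1 w.2.1 w.2.2))

/-- `g` is the restriction `f|_{∂₊SΩ_T}`, taken as a limit along characteristics. -/
def IsOutgoingTrace (Ω : Set (Pos d)) (T : ℝ) (f g : ℝ → Pos d → Dir d → ℝ) : Prop :=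
  ∀ᵐ w ∂(boundaryMeasure Ω T), w.2 ∈ outgoing Ω →
    Tendsto (fun s : ℝ => f (w.1 - s) (w.2.1 - s • (w.2.2 : Pos d)) w.2.2) (𝓝[>] 0)
      (𝓝 (g w.1 w.2.1 w.2.2))

/-- The graph of the measurement operator `𝒜_{σ,μ,N} : (f₀, fm) ↦ f|_{∂₊SΩ_T}`. -/
def IsMeasurement (Ω : Set (Pos d)) (T : ℝ) (σ : Pos d → Dir d → ℝ)
    (μ : Pos d → Dir d → Dir d → ℝ) (N : Pos d → Dir d → ℝ → ℝ)
    (f₀ : Pos d → Dir d → ℝ) (fm g : ℝ → Pos d → Dir d → ℝ) : Prop :=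
  ∃ f, IsSolution Ω T σ μ N f₀ fm f ∧ IsOutgoingTrace Ω T f g

/-- `𝒜_{σ₁,μ,N₁}(h, 0) = 𝒜_{σ₂,μ,N₂}(h, 0)` in `L^∞(∂₊SΩ_T)` for all `h ∈ L^∞(SΩ)` with
`‖h‖_{L^∞(SΩ)} ≤ δ`. -/
def SameMeasurements (Ω : Set (Pos d)) (T δ : ℝ) (μ : Pos d → Dir d → Dir d → ℝ)
    (σ₁ σ₂ : Pos d → Dir d → ℝ) (N₁ N₂ : Pos d → Dir d → ℝ → ℝ) : Prop :=
  ∀ h : Pos d → Dir d → ℝ,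
    MemLp (fun p : Pos d × Dir d => h p.1 p.2) ∞ (phaseMeasure Ω) →
    eLpNorm (fun p : Pos d × Dir d => h p.1 p.2) ∞ (phaseMeasure Ω) ≤ ENNReal.ofReal δ →
    ∀ g₁ g₂ : ℝ → Pos d → Dir d → ℝ,
      IsMeasurement Ω T σ₁ μ N₁ h (fun _ _ _ => 0) g₁ →
      IsMeasurement Ω T σ₂ μ N₂ h (fun _ _ _ => 0) g₂ →
      ∀ᵐ w ∂(boundaryMeasure Ω T), w.2 ∈ outgoing Ω →
        g₁ w.1 w.2.1 w.2.2 = g₂ w.1 w.2.1 w.2.2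

end Transport

end

/-! Write the total loss as g(x,v,z) = σ(x,v) z + N(x,v,z). Scattering is negligible for data
concentrated in few directions. If the initial data are cut off to a set V of directions of measure
η, every scattering integral runs over V at leading order and is O(η). Up to time T the solution
then differs by O(η) from the cut-off of the ballistic solution, the one without scattering
(`exists_isMild_near_ballistic`). Points of the sphere are null for d ≥ 2, so countably many sets V
of measure at most η cover all directions. Each characteristic starting in Ω leaves before T > diam
Ω. Letting η tend to 0, equal measurements give equal exit values of the two ballistic solutions
with the same small data, on almost every characteristic (`ae_exit_of_ae_boundary` carries null sets
from the boundary to the phase space).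

The ballistic equation is an ODE y' = -g(y) on each line, and it can be solved backwards. As data
take the stationary ballistic solution B₁ of the first equation with exit value z
(`exists_isStationary`). The first ballistic solution leaves Ω with the value z, hence so does the
second, which by uniqueness is then the stationary solution B₂ with exit value z. At time 0 this
says B₁ = B₂ in Ω (`stationary_ae_eq`). Differentiating along lines gives g₁(B₁) = g₂(B₁) almost
everywhere (`loss_ae_eq_of_stationary_ae_eq`).

For exit values z > 0 tending to 0, the numbers B₁(x,v) are nonzero and tend to 0. So g₁ and g₂,
analytic in z, agree on a sequence accumulating at 0 and hence identically; their derivatives at 0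
are σ₁ and σ₂, and what remains is N₁ = N₂.

To avoid boundary conditions, the coefficients are replaced by measurable versions defined
everywhere, bounded, globally Lipschitz in z and zero outside Ω. The equation is then posed on the
whole space, where Picard iteration in a weighted norm solves it. -/

noncomputable section

namespace Transport

variable {d : ℕ}

/-! ### Fixed points and Grönwall uniqueness -/

/-- Picard iteration for a map that contracts a weighted supremum norm: near an approximate fixed
point there is a fixed point. -/
theorem exists_fixedPoint_near {X : Type*} [MeasurableSpace X] {Γ : (X → ℝ) → X → ℝ} {W : X → ℝ}
    (hmeas : ∀ f, Measurable f → Measurable (Γ f))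
    (hcontr : ∀ f f' A, 0 ≤ A → Measurable f → Measurable f' →
      (∃ C, ∀ x, |f x| ≤ C * W x) → (∃ C, ∀ x, |f' x| ≤ C * W x) →
      (∀ x, |f x - f' x| ≤ A * W x) → ∀ x, |Γ f x - Γ f' x| ≤ A / 2 * W x)
    {ψ : X → ℝ} (hψ : Measurable ψ) {C : ℝ} (hC : ∀ x, |ψ x| ≤ C * W x) {A : ℝ} (hA : 0 ≤ A)
    (hΓψ : ∀ x, |Γ ψ x - ψ x| ≤ A * W x) :
    ∃ f, Measurable f ∧ (∀ x, |f x - ψ x| ≤ 2 * A * W x) ∧ Γ f = f := by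
  set F : ℕ → X → ℝ := fun n => Γ^[n] ψ with hF
  have hsucc : ∀ n, F (n + 1) = Γ (F n) := fun n => Function.iterate_succ_apply' Γ n ψ
  have hFm : ∀ n, Measurable (F n) := by
    intro n
    induction n with
    | zero => exact hψ
    | succ n ih => rw [hsucc]; exact hmeas _ ih
  have bound_of_near : ∀ (f : X → ℝ) (D : ℝ), (∀ x, |f x - ψ x| ≤ D * W x) →
      ∃ C, ∀ x, |f x| ≤ C * W x := by
    intro f D hD
    refine ⟨D + C, fun x => ?_⟩
    calc |f x| = |(f x - ψ x) + ψ x| := by ring_nf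
      _ ≤ |f x - ψ x| + |ψ x| := abs_add_le _ _
      _ ≤ D * W x + C * W x := add_le_add (hD x) (hC x)
      _ = (D + C) * W x := by ring
  -- The factor 2A - 2A/2^n is the partial sum of the geometric series of increments. It keeps every
  -- iterate in the weighted space, the only place where the contraction is assumed.
  have key : ∀ n, (∀ x, |F n x - ψ x| ≤ (2 * A - 2 * A * (1 / 2) ^ n) * W x) ∧
      ∀ x, |F (n + 1) x - F n x| ≤ A * (1 / 2) ^ n * W x := by
    intro n
    induction n with
    | zero =>
      refine ⟨fun x => by simp [hF], fun x => ?_⟩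
      simpa [hF] using hΓψ x
    | succ n ih =>
      have h1 : ∀ x, |F (n + 1) x - ψ x| ≤ (2 * A - 2 * A * (1 / 2) ^ (n + 1)) * W x := by
        intro x
        calc |F (n + 1) x - ψ x| = |(F (n + 1) x - F n x) + (F n x - ψ x)| := by ring_nf
          _ ≤ _ := abs_add_le _ _
          _ ≤ _ := add_le_add (ih.2 x) (ih.1 x)
          _ = _ := by ring
      refine ⟨h1, fun x => ?_⟩
      have := hcontr (F (n + 1)) (F n) (A * (1 / 2) ^ n) (by positivity) (hFm _) (hFm _)
        (bound_of_near _ _ h1) (bound_of_near _ _ ih.1) ih.2 x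
      rw [← hsucc, ← hsucc] at this
      calc _ ≤ _ := this
        _ = _ := by ring
  have hdist : ∀ x n, dist (F n x) (F (n + 1) x) ≤ (A * W x) * (1 / 2) ^ n := by
    intro x n
    rw [dist_comm, Real.dist_eq]
    calc _ ≤ _ := (key n).2 x
      _ = _ := by ring
  have hlim : ∀ x, ∃ y, Tendsto (fun n => F n x) atTop (𝓝 y) := fun x =>
    cauchySeq_tendsto_of_complete (cauchySeq_of_le_geometric _ _ (by norm_num) (hdist x))
  choose f hf using hlim
  have hfF : ∀ n x, |f x - F n x| ≤ 2 * A * (1 / 2) ^ n * W x := by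
    intro n x
    have := dist_le_of_le_geometric_of_tendsto _ _ (by norm_num) (hdist x) (hf x) n
    rw [dist_comm, Real.dist_eq] at this
    calc _ ≤ _ := this
      _ = _ := by ring
  have hfm : Measurable f := measurable_of_tendsto_metrizable hFm (tendsto_pi_nhds.2 hf)
  have hfψ : ∀ x, |f x - ψ x| ≤ 2 * A * W x := fun x => by simpa [hF] using hfF 0 x
  refine ⟨f, hfm, hfψ, funext fun x => ?_⟩
  have h2 : ∀ n, |Γ f x - F (n + 1) x| ≤ A * W x * (1 / 2) ^ n := by
    intro n
    rw [hsucc]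
    calc _ ≤ _ := hcontr f (F n) (2 * A * (1 / 2) ^ n) (by positivity) hfm (hFm n)
          (bound_of_near _ _ hfψ) (bound_of_near _ _ (key n).1) (hfF n) x
      _ = _ := by ring
  have h3 : Tendsto (fun n => F (n + 1) x) atTop (𝓝 (Γ f x)) := by
    rw [tendsto_iff_dist_tendsto_zero]
    refine squeeze_zero (g := fun n => A * W x * (1 / 2) ^ n) (fun _ => dist_nonneg)
      (fun n => by rw [dist_comm, Real.dist_eq]; exact h2 n) ?_
    have h4 := (tendsto_pow_atTop_nhds_zero_of_lt_one (r := (1 / 2 : ℝ)) (by norm_num)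
      (by norm_num)).const_mul (A * W x)
    rwa [mul_zero] at h4
  exact tendsto_nhds_unique h3 ((tendsto_add_atTop_iff_nat 1).2 (hf x))

/-- A Grönwall uniqueness statement for integral equations. -/
theorem eq_zero_of_integral_equation {u e : ℝ → ℝ} {L s₀ : ℝ}
    (he : ∀ a b, IntervalIntegrable e volume a b)
    (hu : ∀ s, u s = u s₀ + ∫ r in s₀..s, e r) (hL : ∀ r, |e r| ≤ L * |u r|) (h0 : u s₀ = 0) (s : ℝ) :
    u s = 0 := by
  have hucont : Continuous u := by
    have : u = fun s => u s₀ + ∫ r in s₀..s, e r := funext hu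
    rw [this]
    exact continuous_const.add (intervalIntegral.continuous_primitive he s₀)
  -- The case s ≥ s₀ suffices, since reflecting r to -r turns the other case into it. There I(s) = L
  -- ∫ |u| dominates |u| and satisfies I' = L|u|, so it vanishes by Grönwall.
  have forward : ∀ (u e : ℝ → ℝ) (s₀ : ℝ), Continuous u →
      (∀ s, u s = u s₀ + ∫ r in s₀..s, e r) → (∀ r, |e r| ≤ L * |u r|) → u s₀ = 0 →
      ∀ s, s₀ ≤ s → u s = 0 := by
    intro u e s₀ hucont hu hL h0 s hs
    have hint : ∀ a b, IntervalIntegrable (fun r => |u r|) volume a b :=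
      fun a b => hucont.abs.intervalIntegrable a b
    set I : ℝ → ℝ := fun s => L * ∫ r in s₀..s, |u r| with hI
    have hIderiv : ∀ x, HasDerivAt I (L * |u x|) x := fun x =>
      (intervalIntegral.integral_hasDerivAt_right (hint _ _)
        hucont.abs.aestronglyMeasurable.stronglyMeasurableAtFilter
        hucont.abs.continuousAt).const_mul L
    have hle : ∀ x, s₀ ≤ x → |u x| ≤ I x := by
      intro x hx
      rw [hu x, h0, zero_add, hI]
      simp only
      rw [← intervalIntegral.integral_const_mul]
      rw [← Real.norm_eq_abs]
      exact intervalIntegral.norm_integral_le_of_norm_le hx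
        (Eventually.of_forall fun r _ => hL r) ((hint _ _).const_mul L)
    have hb : ∀ x ∈ Ico s₀ s, ‖L * |u x|‖ ≤ |L| * ‖I x‖ := by
      intro x hx
      rw [Real.norm_eq_abs, Real.norm_eq_abs, abs_mul, abs_abs]
      exact mul_le_mul_of_nonneg_left ((hle x hx.1).trans (le_abs_self _)) (abs_nonneg _)
    have hI0 : I s = 0 := by
      refine eq_zero_of_abs_deriv_le_mul_abs_self_of_eq_zero_right
        (fun x _ => (hIderiv x).continuousAt.continuousWithinAt)
        (fun x _ => (hIderiv x).hasDerivWithinAt) ?_ hb s ⟨hs, le_rfl⟩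
      simp [hI]
    have hus : |u s| ≤ 0 := (hle s hs).trans_eq hI0
    exact abs_nonpos_iff.1 hus
  rcases le_total s₀ s with hs | hs
  · exact forward u e s₀ hucont hu hL h0 s hs
  · have := forward (fun r => u (-r)) (fun r => -e (-r)) (-s₀) (hucont.comp continuous_neg)
      (fun s => ?_) (fun r => by simpa using hL (-r)) (by simpa using h0) (-s) (by linarith)
    · simpa using this
    · simp only [neg_neg]
      rw [hu (-s), intervalIntegral.integral_neg, intervalIntegral.integral_comp_neg (fun r => e r),
        neg_neg, intervalIntegral.integral_symm]

/-! ### Measures on the sphere and on the phase space -/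

instance isProbabilityMeasure_sphereMeasure [NeZero d] : IsProbabilityMeasure (sphereMeasure d) := by
  have : Nontrivial (Pos d) := by
    have : Nonempty (Fin d) := ⟨⟨0, Nat.pos_of_ne_zero (NeZero.ne d)⟩⟩
    exact inferInstanceAs (Nontrivial (EuclideanSpace ℝ (Fin d)))
  refine ⟨?_⟩
  rw [sphereMeasure, Measure.smul_apply, smul_eq_mul]
  exact ENNReal.inv_mul_cancel
    (fun h => Measure.toSphere_ne_zero (volume : Measure (Pos d)) (Measure.measure_univ_eq_zero.1 h))
    (measure_ne_top _ _)

-- The cone over a point lies in a line, which is Lebesgue-null because d ≥ 2.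
open scoped Pointwise in
theorem sphereMeasure_singleton (hd : 2 ≤ d) (v : Dir d) : sphereMeasure d {v} = 0 := by
  rw [sphereMeasure, Measure.smul_apply, Measure.toSphere_apply' _ (measurableSet_singleton v)]
  have hsub : Ioo (0 : ℝ) 1 • Subtype.val '' ({v} : Set (Dir d)) ⊆
      ((ℝ ∙ (v : Pos d) : Submodule ℝ (Pos d)) : Set (Pos d)) := by
    rintro x ⟨a, -, b, hb, rfl⟩
    rw [image_singleton, mem_singleton_iff] at hb
    subst hb
    exact Submodule.smul_mem _ _ (Submodule.mem_span_singleton_self _)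
  have hne : (ℝ ∙ (v : Pos d) : Submodule ℝ (Pos d)) ≠ ⊤ := by
    intro h
    have h1 := finrank_span_le_card (R := ℝ) ({(v : Pos d)} : Set (Pos d))
    rw [h, finrank_top, finrank_euclideanSpace_fin, toFinset_singleton, Finset.card_singleton] at h1
    omega
  rw [measure_mono_null hsub (Measure.addHaar_submodule _ _ hne)]
  simp

/-- The directions can be covered by countably many open sets of small measure. -/
theorem exists_small_cover [NeZero d] (hd : 2 ≤ d) {η : ℝ} (hη : 0 < η) :
    ∃ V : ℕ → Set (Dir d), (∀ i, MeasurableSet (V i)) ∧ (∀ i, (sphereMeasure d).real (V i) ≤ η) ∧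
      ∀ v, ∃ i, v ∈ V i := by
  have h1 : ∀ v : Dir d, ∃ r > 0, (sphereMeasure d).real (Metric.closedBall v r) ≤ η := by
    intro v
    have ht : Tendsto (fun r => sphereMeasure d (Metric.closedBall v r)) (𝓝[>] 0)
        (𝓝 (sphereMeasure d (⋂ r > (0 : ℝ), Metric.closedBall v r))) := by
      refine tendsto_measure_biInter_gt (fun r _ => Metric.isClosed_closedBall.measurableSet.nullMeasurableSet)
        (fun i j _ hij => Metric.closedBall_subset_closedBall hij) ⟨1, one_pos, measure_ne_top _ _⟩
    have h0 : (⋂ r > (0 : ℝ), Metric.closedBall v r) = {v} := by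
      ext w
      simp only [mem_iInter, Metric.mem_closedBall, mem_singleton_iff]
      refine ⟨fun h => dist_le_zero.1 (le_of_forall_gt_imp_ge_of_dense fun r hr => h r hr), ?_⟩
      rintro rfl r hr
      simpa using hr.le
    rw [h0, sphereMeasure_singleton hd] at ht
    have := (ht.eventually (gt_mem_nhds (ENNReal.ofReal_pos.2 hη))).and self_mem_nhdsWithin
    obtain ⟨r, hr, hr0⟩ := this.exists
    exact ⟨r, hr0, ENNReal.toReal_le_of_le_ofReal hη.le hr.le⟩
  choose r hr hrη using h1
  obtain ⟨s, hs, hsU⟩ := TopologicalSpace.countable_cover_nhds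
    (f := fun v => Metric.closedBall v (r v)) fun v => Metric.closedBall_mem_nhds v (hr v)
  have hne : s.Nonempty := by
    by_contra h
    rw [not_nonempty_iff_eq_empty] at h
    subst h
    have hp : (⟨EuclideanSpace.single ⟨0, by omega⟩ 1, by simp⟩ : Dir d) ∈ (univ : Set (Dir d)) := mem_univ _
    rw [← hsU] at hp
    simp at hp
  obtain ⟨c, rfl⟩ := hs.exists_eq_range hne
  refine ⟨fun i => Metric.closedBall (c i) (r (c i)), fun i => Metric.isClosed_closedBall.measurableSet,
    fun i => hrη _, fun v => ?_⟩
  have hv : v ∈ (univ : Set (Dir d)) := mem_univ v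
  rw [← hsU] at hv
  simpa using hv

/-- Free transport preserves the phase space measure. -/
theorem measurePreserving_shear [NeZero d] (r : ℝ) :
    MeasurePreserving (fun p : Pos d × Dir d => (p.1 + r • (p.2 : Pos d), p.2))
      ((volume : Measure (Pos d)).prod (sphereMeasure d))
      ((volume : Measure (Pos d)).prod (sphereMeasure d)) := by
  have h := MeasurePreserving.skew_product (MeasurePreserving.id (sphereMeasure d))
    (μc := (volume : Measure (Pos d))) (μd := (volume : Measure (Pos d)))
    (g := fun v x => x + r • (v : Pos d)) (by fun_prop)
    (Eventually.of_forall fun v => (measurePreserving_add_right volume (r • (v : Pos d))).map_eq)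
  exact (Measure.measurePreserving_swap.comp h).comp Measure.measurePreserving_swap

/-- For each fixed r the shear along v preserves null sets; Fubini then exchanges "every r, almost
every p" for "almost every p, almost every r". -/
theorem ae_line_of_ae [NeZero d] {P : Pos d → Dir d → Prop}
    (h : ∀ᵐ p ∂((volume : Measure (Pos d)).prod (sphereMeasure d)), P p.1 p.2) :
    ∀ᵐ p ∂((volume : Measure (Pos d)).prod (sphereMeasure d)), ∀ᵐ r : ℝ,
      P (p.1 + r • (p.2 : Pos d)) p.2 := by
  obtain ⟨Z, hsub, hZ, hZ0⟩ := exists_measurable_superset_of_null h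
  have hZm : MeasurableSet {q : (Pos d × Dir d) × ℝ | (q.1.1 + q.2 • (q.1.2 : Pos d), q.1.2) ∉ Z} := by
    have : Measurable fun q : (Pos d × Dir d) × ℝ => (q.1.1 + q.2 • (q.1.2 : Pos d), q.1.2) := by
      fun_prop
    exact this hZ.compl
  have h1 : ∀ᵐ p ∂((volume : Measure (Pos d)).prod (sphereMeasure d)), ∀ᵐ r : ℝ,
      (p.1 + r • (p.2 : Pos d), p.2) ∉ Z := by
    refine (Measure.ae_ae_comm hZm).2 (Eventually.of_forall fun r => ?_)
    exact (measurePreserving_shear r).quasiMeasurePreserving.ae (measure_eq_zero_iff_ae_notMem.1 hZ0)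
  filter_upwards [h1] with p hp
  filter_upwards [hp] with r hr
  by_contra hn
  exact hr (hsub hn)

/-- Converse of `ae_line_of_ae`: by Fubini some shift r is good for almost every p, and shearing
back by r removes it. -/
theorem ae_of_ae_line [NeZero d] {P : Pos d → Dir d → Prop}
    (hP : MeasurableSet {p : Pos d × Dir d | P p.1 p.2})
    (h : ∀ᵐ p ∂((volume : Measure (Pos d)).prod (sphereMeasure d)), ∀ᵐ r : ℝ,
      P (p.1 + r • (p.2 : Pos d)) p.2) :
    ∀ᵐ p ∂((volume : Measure (Pos d)).prod (sphereMeasure d)), P p.1 p.2 := by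
  have hm : MeasurableSet {q : (Pos d × Dir d) × ℝ | P (q.1.1 + q.2 • (q.1.2 : Pos d)) q.1.2} := by
    have : Measurable fun q : (Pos d × Dir d) × ℝ => (q.1.1 + q.2 • (q.1.2 : Pos d), q.1.2) := by
      fun_prop
    exact this hP
  have h1 := (Measure.ae_ae_comm hm).1 h
  obtain ⟨r, hr⟩ := h1.exists
  filter_upwards [(measurePreserving_shear (-r)).quasiMeasurePreserving.ae hr] with p hp
  simpa using hp

/-! ### The transport equation in the whole space -/

section

/-- A loss term that is jointly measurable, globally Lipschitz in `z`, vanishes at `z = 0` and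
outside `Ω`. -/
structure IsLoss (Ω : Set (Pos d)) (L : ℝ) (g : Pos d → Dir d → ℝ → ℝ) : Prop where
  measurable : Measurable fun q : (Pos d × Dir d) × ℝ => g q.1.1 q.1.2 q.2
  lipschitz : ∀ x v z z', |g x v z - g x v z'| ≤ L * |z - z'|
  zero : ∀ x v, g x v 0 = 0
  outside : ∀ x, x ∉ Ω → ∀ v z, g x v z = 0

/-- A bounded measurable scattering kernel that vanishes outside `Ω`. -/
structure IsKernel (Ω : Set (Pos d)) (M : ℝ) (m : Pos d → Dir d → Dir d → ℝ) : Prop where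
  measurable : Measurable fun q : Pos d × Dir d × Dir d => m q.1 q.2.1 q.2.2
  bound : ∀ x v' v, |m x v' v| ≤ M
  outside : ∀ x, x ∉ Ω → ∀ v' v, m x v' v = 0

/-- The derivative along characteristics that the equation with loss term `g` prescribes. -/
def rate (m : Pos d → Dir d → Dir d → ℝ) (g : Pos d → Dir d → ℝ → ℝ) (f : ℝ → Pos d → Dir d → ℝ)
    (t : ℝ) (x : Pos d) (v : Dir d) : ℝ :=
  scattering m f t x v - g x v (f t x v)

/-- The right-hand side of the Duhamel formula in the whole space. -/
def duhamel (m : Pos d → Dir d → Dir d → ℝ) (g : Pos d → Dir d → ℝ → ℝ) (h : Pos d → Dir d → ℝ)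
    (f : ℝ → Pos d → Dir d → ℝ) (t : ℝ) (x : Pos d) (v : Dir d) : ℝ :=
  h (x - t • (v : Pos d)) v + ∫ r in (0 : ℝ)..t, rate m g f r (x - (t - r) • (v : Pos d)) v

/-- A jointly measurable solution in the whole space, of at most exponential growth in time. -/
structure IsMild (m : Pos d → Dir d → Dir d → ℝ) (g : Pos d → Dir d → ℝ → ℝ) (h : Pos d → Dir d → ℝ)
    (K C : ℝ) (f : ℝ → Pos d → Dir d → ℝ) : Prop where
  measurable : Measurable fun w : ℝ × Pos d × Dir d => f w.1 w.2.1 w.2.2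
  bound : ∀ t x v, |f t x v| ≤ C * Real.exp (K * |t|)
  eq : ∀ t x v, f t x v = duhamel m g h f t x v

variable {Ω : Set (Pos d)} {L M K : ℝ} {g : Pos d → Dir d → ℝ → ℝ}
  {m : Pos d → Dir d → Dir d → ℝ} {h : Pos d → Dir d → ℝ} {f f' : ℝ → Pos d → Dir d → ℝ}

theorem IsLoss.nonneg [NeZero d] (hg : IsLoss Ω L g) : 0 ≤ L := by
  have h1 := hg.lipschitz 0 ⟨EuclideanSpace.single ⟨0, Nat.pos_of_ne_zero (NeZero.ne d)⟩ 1, by simp⟩ 1 0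
  have h2 := (abs_nonneg _).trans h1
  simpa using h2

theorem IsLoss.abs_le (hg : IsLoss Ω L g) (x : Pos d) (v : Dir d) (z : ℝ) : |g x v z| ≤ L * |z| := by
  simpa [hg.zero] using hg.lipschitz x v z 0

theorem IsKernel.nonneg [NeZero d] (hm : IsKernel Ω M m) : 0 ≤ M := by
  set v : Dir d := ⟨EuclideanSpace.single ⟨0, Nat.pos_of_ne_zero (NeZero.ne d)⟩ 1, by simp⟩
  exact (abs_nonneg _).trans (hm.bound 0 v v)

theorem isKernel_zero (hM : 0 ≤ M) : IsKernel Ω M (fun (_ : Pos d) _ _ => (0 : ℝ)) :=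
  ⟨measurable_const, fun _ _ _ => by simpa using hM, fun _ _ _ _ => rfl⟩

theorem measurable_scattering [NeZero d] (hm : IsKernel Ω M m)
    (hf : Measurable fun w : ℝ × Pos d × Dir d => f w.1 w.2.1 w.2.2) :
    Measurable fun w : ℝ × Pos d × Dir d => scattering m f w.1 w.2.1 w.2.2 := by
  refine StronglyMeasurable.measurable ?_
  refine StronglyMeasurable.integral_prod_right
    (f := fun (w : ℝ × Pos d × Dir d) (v' : Dir d) => m w.2.1 v' w.2.2 * f w.1 w.2.1 v') ?_
  refine Measurable.stronglyMeasurable ?_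
  refine Measurable.mul ?_ ?_
  · exact hm.measurable.comp (f := fun q : (ℝ × Pos d × Dir d) × Dir d => (q.1.2.1, q.2, q.1.2.2))
      (by fun_prop)
  · exact hf.comp (f := fun q : (ℝ × Pos d × Dir d) × Dir d => (q.1.1, q.1.2.1, q.2)) (by fun_prop)

theorem measurable_rate [NeZero d] (hg : IsLoss Ω L g) (hm : IsKernel Ω M m)
    (hf : Measurable fun w : ℝ × Pos d × Dir d => f w.1 w.2.1 w.2.2) :
    Measurable fun w : ℝ × Pos d × Dir d => rate m g f w.1 w.2.1 w.2.2 :=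
  (measurable_scattering hm hf).sub
    (hg.measurable.comp (f := fun w : ℝ × Pos d × Dir d => ((w.2.1, w.2.2), f w.1 w.2.1 w.2.2))
      (by fun_prop))

theorem measurable_duhamel [NeZero d] (hg : IsLoss Ω L g) (hm : IsKernel Ω M m)
    (hh : Measurable fun p : Pos d × Dir d => h p.1 p.2)
    (hf : Measurable fun w : ℝ × Pos d × Dir d => f w.1 w.2.1 w.2.2) :
    Measurable fun w : ℝ × Pos d × Dir d => duhamel m g h f w.1 w.2.1 w.2.2 := by
  refine Measurable.add (hh.comp (f := fun w : ℝ × Pos d × Dir d =>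
    (w.2.1 - w.1 • (w.2.2 : Pos d), w.2.2)) (by fun_prop)) ?_
  -- The substitution r = t u moves the integral to a fixed interval, so that measurability in the
  -- parameters follows from Fubini.
  have heq : (fun w : ℝ × Pos d × Dir d => ∫ r in (0 : ℝ)..w.1,
      rate m g f r (w.2.1 - (w.1 - r) • (w.2.2 : Pos d)) w.2.2) = fun w => w.1 * ∫ u in Ioc (0 : ℝ) 1,
        rate m g f (w.1 * u) (w.2.1 - (w.1 - w.1 * u) • (w.2.2 : Pos d)) w.2.2 := by
    funext w
    have := intervalIntegral.smul_integral_comp_mul_left (a := 0) (b := 1)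
      (fun r => rate m g f r (w.2.1 - (w.1 - r) • (w.2.2 : Pos d)) w.2.2) w.1
    rw [mul_zero, mul_one] at this
    rw [← this, smul_eq_mul, intervalIntegral.integral_of_le zero_le_one]
  rw [heq]
  refine measurable_fst.mul (StronglyMeasurable.measurable ?_)
  refine StronglyMeasurable.integral_prod_right
    (f := fun (w : ℝ × Pos d × Dir d) (u : ℝ) =>
      rate m g f (w.1 * u) (w.2.1 - (w.1 - w.1 * u) • (w.2.2 : Pos d)) w.2.2) ?_
  exact ((measurable_rate hg hm hf).comp (f := fun q : (ℝ × Pos d × Dir d) × ℝ =>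
    (q.1.1 * q.2, q.1.2.1 - (q.1.1 - q.1.1 * q.2) • (q.1.2.2 : Pos d), q.1.2.2))
      (by fun_prop)).stronglyMeasurable

theorem integrable_kernel_mul [NeZero d] (hm : IsKernel Ω M m)
    (hf : Measurable fun w : ℝ × Pos d × Dir d => f w.1 w.2.1 w.2.2) {t : ℝ} {x : Pos d} {C : ℝ}
    (hC : ∀ v, |f t x v| ≤ C) (v : Dir d) :
    Integrable (fun v' => m x v' v * f t x v') (sphereMeasure d) := by
  have hC0 : 0 ≤ C := (abs_nonneg _).trans (hC v)
  refine Integrable.of_bound (C := M * C) ?_ (Eventually.of_forall fun v' => ?_)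
  · refine Measurable.aestronglyMeasurable (Measurable.mul ?_ ?_)
    · exact hm.measurable.comp (f := fun v' : Dir d => (x, v', v)) (by fun_prop)
    · exact hf.comp (f := fun v' : Dir d => (t, x, v')) (by fun_prop)
  · rw [norm_mul]
    exact mul_le_mul (hm.bound _ _ _) (hC v') (abs_nonneg _) hm.nonneg

theorem abs_rate_sub_le [NeZero d] (hg : IsLoss Ω L g) (hm : IsKernel Ω M m)
    (hf : Measurable fun w : ℝ × Pos d × Dir d => f w.1 w.2.1 w.2.2)
    (hf' : Measurable fun w : ℝ × Pos d × Dir d => f' w.1 w.2.1 w.2.2) {t : ℝ} {x : Pos d}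
    {C C' A : ℝ} (hC : ∀ v, |f t x v| ≤ C) (hC' : ∀ v, |f' t x v| ≤ C')
    (hA : ∀ v, |f t x v - f' t x v| ≤ A) (v : Dir d) :
    |rate m g f t x v - rate m g f' t x v| ≤ (M + L) * A := by
  have h1 : |scattering m f t x v - scattering m f' t x v| ≤ M * A := by
    rw [scattering, scattering, ← integral_sub (integrable_kernel_mul hm hf hC v)
      (integrable_kernel_mul hm hf' hC' v)]
    have := norm_integral_le_of_norm_le_const (μ := sphereMeasure d) (C := M * A)
      (f := fun v' => m x v' v * f t x v' - m x v' v * f' t x v')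
      (Eventually.of_forall fun v' => by
        rw [← mul_sub, norm_mul]
        exact mul_le_mul (hm.bound _ _ _) (hA v') (abs_nonneg _) hm.nonneg)
    simpa using this
  have h2 : |g x v (f t x v) - g x v (f' t x v)| ≤ L * A :=
    (hg.lipschitz _ _ _ _).trans (mul_le_mul_of_nonneg_left (hA v) hg.nonneg)
  calc |rate m g f t x v - rate m g f' t x v|
      = |(scattering m f t x v - scattering m f' t x v) -
          (g x v (f t x v) - g x v (f' t x v))| := by rw [rate, rate]; ring_nf
    _ ≤ _ := abs_sub _ _
    _ ≤ M * A + L * A := add_le_add h1 h2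
    _ = (M + L) * A := by ring

theorem abs_rate_le [NeZero d] (hg : IsLoss Ω L g) (hm : IsKernel Ω M m)
    (hf : Measurable fun w : ℝ × Pos d × Dir d => f w.1 w.2.1 w.2.2) {t : ℝ} {x : Pos d}
    {C : ℝ} (hC : ∀ v, |f t x v| ≤ C) (v : Dir d) :
    |rate m g f t x v| ≤ (M + L) * C := by
  have h0 : rate m g (fun _ _ _ => 0) t x v = 0 := by simp [rate, scattering, hg.zero]
  have := abs_rate_sub_le hg hm hf (f' := fun _ _ _ => 0) measurable_const hC (C' := 0)
    (by simp) (A := C) (by simpa using hC) v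
  rwa [h0, sub_zero] at this

theorem rate_outside (hg : IsLoss Ω L g) (hm : IsKernel Ω M m) {x : Pos d} (hx : x ∉ Ω) (t : ℝ)
    (v : Dir d) : rate m g f t x v = 0 := by
  simp [rate, scattering, hg.outside x hx, hm.outside x hx]

/-- Time integration gains a factor 1/K in the norm weighted by exp(K|t|), which makes the Duhamel
map a contraction for large K without restricting time. -/
theorem integral_exp_mul_abs_le (hK : 0 < K) (t : ℝ) :
    |∫ r in (0 : ℝ)..t, Real.exp (K * |r|)| ≤ Real.exp (K * |t|) / K := by
  have pos : ∀ t : ℝ, 0 ≤ t → |∫ r in (0 : ℝ)..t, Real.exp (K * |r|)| ≤ Real.exp (K * |t|) / K := by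
    intro t ht
    have h1 : ∫ r in (0 : ℝ)..t, Real.exp (K * |r|) = ∫ r in (0 : ℝ)..t, Real.exp (K * r) := by
      refine intervalIntegral.integral_congr fun r hr => ?_
      rw [uIcc_of_le ht] at hr
      simp only [abs_of_nonneg hr.1]
    have h2 : ∫ r in (0 : ℝ)..t, Real.exp (K * r) = Real.exp (K * t) / K - Real.exp (K * 0) / K := by
      refine intervalIntegral.integral_eq_sub_of_hasDerivAt
        (f := fun r => Real.exp (K * r) / K) (fun r _ => ?_)
        (Continuous.intervalIntegrable (by fun_prop) _ _)
      have := (((hasDerivAt_id r).const_mul K).exp).div_const K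
      simpa [hK.ne'] using this
    rw [h1, h2, abs_of_nonneg ht, mul_zero, Real.exp_zero, ← sub_div, abs_of_nonneg]
    · gcongr
      linarith
    · have : 1 ≤ Real.exp (K * t) := Real.one_le_exp (by positivity)
      exact div_nonneg (by linarith) hK.le
  rcases le_total 0 t with ht | ht
  · exact pos t ht
  · have h1 := pos (-t) (by linarith)
    have h2 := intervalIntegral.integral_comp_neg (a := 0) (b := t) fun r => Real.exp (K * |r|)
    simp only [abs_neg, neg_zero] at h1 h2
    rw [h2, intervalIntegral.integral_symm, abs_neg]
    exact h1

theorem abs_integral_le_of_exp_bound (hK : 0 < K) {A : ℝ} (hA : 0 ≤ A) {e : ℝ → ℝ}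
    (he : ∀ r, |e r| ≤ A * Real.exp (K * |r|)) (t : ℝ) :
    |∫ r in (0 : ℝ)..t, e r| ≤ A / K * Real.exp (K * |t|) := by
  have h1 := intervalIntegral.norm_integral_le_abs_of_norm_le (μ := volume) (a := 0) (b := t) (f := e)
    (g := fun r => A * Real.exp (K * |r|)) (Eventually.of_forall he)
    (Continuous.intervalIntegrable (by fun_prop) _ _)
  rw [intervalIntegral.integral_const_mul, abs_mul, abs_of_nonneg hA] at h1
  calc _ ≤ _ := h1
    _ ≤ A * (Real.exp (K * |t|) / K) :=
      mul_le_mul_of_nonneg_left (integral_exp_mul_abs_le hK t) hA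
    _ = _ := by ring

theorem intervalIntegrable_of_exp_bound {A : ℝ} {e : ℝ → ℝ} (hem : Measurable e)
    (he : ∀ r, |e r| ≤ A * Real.exp (K * |r|)) (a b : ℝ) : IntervalIntegrable e volume a b := by
  have h1 : IntervalIntegrable (fun r => A * Real.exp (K * |r|)) volume a b :=
    Continuous.intervalIntegrable (by fun_prop) _ _
  exact h1.mono_fun hem.aestronglyMeasurable (Eventually.of_forall fun r =>
    (he r).trans (le_abs_self _))

theorem intervalIntegrable_rate_duhamel [NeZero d] (hg : IsLoss Ω L g) (hm : IsKernel Ω M m)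
    (hf : Measurable fun w : ℝ × Pos d × Dir d => f w.1 w.2.1 w.2.2) {C : ℝ}
    (hC : ∀ t x v, |f t x v| ≤ C * Real.exp (K * |t|)) (t : ℝ) (x : Pos d) (v : Dir d) (a b : ℝ) :
    IntervalIntegrable (fun r => rate m g f r (x - (t - r) • (v : Pos d)) v) volume a b := by
  refine intervalIntegrable_of_exp_bound (K := K) (A := (M + L) * C)
    ((measurable_rate hg hm hf).comp (f := fun r : ℝ => (r, x - (t - r) • (v : Pos d), v))
      (by fun_prop)) (fun r => ?_) a b
  rw [mul_assoc]
  exact abs_rate_le hg hm hf (fun v => hC _ _ v) v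

/-- Near an approximate solution of the transport equation there is a solution. -/
theorem exists_isMild_near [NeZero d] (hg : IsLoss Ω L g) (hm : IsKernel Ω M m)
    (hK : K = 2 * (M + L + 1))
    (hh : Measurable fun p : Pos d × Dir d => h p.1 p.2)
    {ψ : ℝ → Pos d → Dir d → ℝ} (hψ : Measurable fun w : ℝ × Pos d × Dir d => ψ w.1 w.2.1 w.2.2)
    {C A : ℝ} (hC : ∀ t x v, |ψ t x v| ≤ C * Real.exp (K * |t|)) (hA : 0 ≤ A)
    (hψA : ∀ t x v, |duhamel m g h ψ t x v - ψ t x v| ≤ A * Real.exp (K * |t|)) :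
    ∃ f, IsMild m g h K (C + 2 * A) f ∧
      ∀ t x v, |f t x v - ψ t x v| ≤ 2 * A * Real.exp (K * |t|) := by
  have hML : 0 ≤ M + L := add_nonneg hm.nonneg hg.nonneg
  have hK0 : 0 < K := by rw [hK]; linarith
  obtain ⟨F, hFm, hFψ, hF⟩ := exists_fixedPoint_near
    (X := ℝ × Pos d × Dir d)
    (Γ := fun F w => duhamel m g h (fun t x v => F (t, x, v)) w.1 w.2.1 w.2.2)
    (W := fun w => Real.exp (K * |w.1|))
    (fun F hF => measurable_duhamel hg hm hh hF)
    (by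
      rintro F F' A hA hF hF' ⟨C, hC⟩ ⟨C', hC'⟩ hFF' ⟨t, x, v⟩
      simp only [duhamel]
      have hi := intervalIntegrable_rate_duhamel (f := fun t x v => F (t, x, v)) hg hm hF
        (fun t x v => hC (t, x, v)) t x v 0 t
      have hi' := intervalIntegrable_rate_duhamel (f := fun t x v => F' (t, x, v)) hg hm hF'
        (fun t x v => hC' (t, x, v)) t x v 0 t
      rw [add_sub_add_left_eq_sub, ← intervalIntegral.integral_sub hi hi']
      refine (abs_integral_le_of_exp_bound hK0 (A := (M + L) * A) (by positivity) (fun r => ?_)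
        t).trans ?_
      · rw [mul_assoc]
        exact abs_rate_sub_le hg hm (f := fun t x v => F (t, x, v))
          (f' := fun t x v => F' (t, x, v)) hF hF' (C := C * Real.exp (K * |r|))
          (C' := C' * Real.exp (K * |r|)) (fun v => hC (r, _, v)) (fun v => hC' (r, _, v))
          (fun v => hFF' (r, _, v)) v
      -- The choice K = 2(M + L + 1) is made for (M + L)/K ≤ 1/2.
      · refine mul_le_mul_of_nonneg_right ?_ (Real.exp_pos _).le
        rw [div_le_div_iff₀ hK0 two_pos, hK]
        nlinarith)
    hψ (fun w => hC w.1 w.2.1 w.2.2) hA (fun w => hψA w.1 w.2.1 w.2.2)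
  refine ⟨fun t x v => F (t, x, v), ⟨hFm, fun t x v => ?_, fun t x v => ?_⟩,
    fun t x v => hFψ (t, x, v)⟩
  · calc |F (t, x, v)| = |(F (t, x, v) - ψ t x v) + ψ t x v| := by ring_nf
      _ ≤ _ := abs_add_le _ _
      _ ≤ _ := add_le_add (hFψ (t, x, v)) (hC t x v)
      _ = _ := by ring
  · exact (congrFun hF (t, x, v)).symm

/-- Free transport of the data serves as the approximate solution: its defect is the integral of the
rate, at most (M + L)H/K ≤ H in the weighted norm. The constant is H + 2H. -/
theorem exists_isMild [NeZero d] (hg : IsLoss Ω L g) (hm : IsKernel Ω M m)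
    (hK : K = 2 * (M + L + 1)) (hh : Measurable fun p : Pos d × Dir d => h p.1 p.2) {H : ℝ}
    (hH0 : 0 ≤ H) (hH : ∀ x v, |h x v| ≤ H) : ∃ f, IsMild m g h K (3 * H) f := by
  have hML : 0 ≤ M + L := add_nonneg hm.nonneg hg.nonneg
  have hK0 : 0 < K := by rw [hK]; linarith
  have hψ : Measurable fun w : ℝ × Pos d × Dir d => h (w.2.1 - w.1 • (w.2.2 : Pos d)) w.2.2 :=
    hh.comp (f := fun w : ℝ × Pos d × Dir d => (w.2.1 - w.1 • (w.2.2 : Pos d), w.2.2)) (by fun_prop)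
  have hexp : ∀ t, 1 ≤ Real.exp (K * |t|) := fun t => Real.one_le_exp (by positivity)
  have hC : ∀ (t : ℝ) (x : Pos d) (v : Dir d),
      |h (x - t • (v : Pos d)) v| ≤ H * Real.exp (K * |t|) := fun t x v =>
    (hH _ _).trans (le_mul_of_one_le_right hH0 (hexp t))
  have happrox : ∀ (t : ℝ) (x : Pos d) (v : Dir d),
      |duhamel m g h (fun t x v => h (x - t • (v : Pos d)) v) t x v - h (x - t • (v : Pos d)) v| ≤
        H * Real.exp (K * |t|) := by
    intro t x v
    rw [duhamel, add_sub_cancel_left]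
    refine (abs_integral_le_of_exp_bound hK0 (A := (M + L) * H) (by positivity) (fun r => ?_)
      t).trans ?_
    · rw [mul_assoc]
      exact abs_rate_le hg hm hψ (C := H * Real.exp (K * |r|)) (hC r (x - (t - r) • (v : Pos d))) v
    · refine mul_le_mul_of_nonneg_right ?_ (Real.exp_pos _).le
      rw [div_le_iff₀ hK0, hK]
      nlinarith
  obtain ⟨f, hf, -⟩ := exists_isMild_near hg hm hK hh hψ hC hH0 happrox
  exact ⟨f, by convert hf using 1; ring⟩

/-- For initial data concentrated on a set of directions of small measure, the solution is close to
the ballistic one. -/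
theorem exists_isMild_near_ballistic [NeZero d] (hg : IsLoss Ω L g) (hm : IsKernel Ω M m)
    (hK : K = 2 * (M + L + 1)) (hh : Measurable fun p : Pos d × Dir d => h p.1 p.2) {C : ℝ}
    {φ : ℝ → Pos d → Dir d → ℝ} (hφ : IsMild (fun _ _ _ => 0) g h K C φ) {V : Set (Dir d)}
    (hV : MeasurableSet V) {η : ℝ} (hη : (sphereMeasure d).real V ≤ η) (hC0 : 0 ≤ C) :
    ∃ f, IsMild m g (fun x v => V.indicator (h x) v) K (C + C * η) f ∧
      ∀ t x v, |f t x v - V.indicator (φ t x) v| ≤ C * η * Real.exp (K * |t|) := by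
  have hML : 0 ≤ M + L := add_nonneg hm.nonneg hg.nonneg
  have hM := hm.nonneg
  have hL := hg.nonneg
  have hη0 : 0 ≤ η := measureReal_nonneg.trans hη
  have hK0 : 0 < K := by rw [hK]; linarith
  have hh' : Measurable fun p : Pos d × Dir d => V.indicator (h p.1) p.2 := by
    have : (fun p : Pos d × Dir d => V.indicator (h p.1) p.2) =
        (Prod.snd ⁻¹' V).indicator fun p : Pos d × Dir d => h p.1 p.2 := by
      funext p; by_cases hv : p.2 ∈ V <;> simp [hv]
    rw [this]
    exact hh.indicator (measurable_snd hV)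
  have hψ : Measurable fun w : ℝ × Pos d × Dir d => V.indicator (φ w.1 w.2.1) w.2.2 := by
    have : (fun w : ℝ × Pos d × Dir d => V.indicator (φ w.1 w.2.1) w.2.2) =
        ((fun w : ℝ × Pos d × Dir d => w.2.2) ⁻¹' V).indicator
          fun w : ℝ × Pos d × Dir d => φ w.1 w.2.1 w.2.2 := by
      funext p; by_cases hv : p.2.2 ∈ V <;> simp [hv]
    rw [this]
    exact hφ.measurable.indicator ((measurable_snd.comp measurable_snd) hV)
  have hψC : ∀ t x v, |V.indicator (φ t x) v| ≤ C * Real.exp (K * |t|) := by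
    intro t x v
    by_cases hv : v ∈ V
    · rw [indicator_of_mem hv]; exact hφ.bound t x v
    · rw [indicator_of_notMem hv, abs_zero]; positivity
  -- The source of smallness: the integrand lives on V, whose measure is at most η.
  have hscat : ∀ t x v, |scattering m (fun t x v => V.indicator (φ t x) v) t x v| ≤
      M * (C * η) * Real.exp (K * |t|) := by
    intro t x v
    have h1 : (fun v' => m x v' v * V.indicator (φ t x) v') =
        V.indicator fun v' => m x v' v * φ t x v' := by
      funext v'
      by_cases hv : v' ∈ V <;> simp [hv]
    rw [scattering, h1, integral_indicator hV]
    have h2 := norm_setIntegral_le_of_norm_le_const (μ := sphereMeasure d) (s := V)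
      (f := fun v' => m x v' v * φ t x v') (C := M * (C * Real.exp (K * |t|))) (measure_lt_top _ _)
      (fun v' _ => by
        rw [norm_mul]
        exact mul_le_mul (hm.bound _ _ _) (hφ.bound _ _ _) (abs_nonneg _) hM)
    calc _ ≤ _ := h2
      _ ≤ M * (C * Real.exp (K * |t|)) * η := by gcongr
      _ = _ := by ring
  -- Since the loss vanishes at 0, it commutes with the cut-off in v; only scattering sees
  -- directions outside V.
  have hrate : ∀ t x v, rate m g (fun t x v => V.indicator (φ t x) v) t x v =
      scattering m (fun t x v => V.indicator (φ t x) v) t x v +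
        V.indicator (fun v => rate (fun _ _ _ => 0) g φ t x v) v := by
    intro t x v
    by_cases hv : v ∈ V
    · simp [rate, hv, scattering]; ring
    · simp [rate, hv, hg.zero]
  have hsm : Measurable fun w : ℝ × Pos d × Dir d =>
      scattering m (fun t x v => V.indicator (φ t x) v) w.1 w.2.1 w.2.2 :=
    measurable_scattering hm hψ
  -- The defect of the cut-off ballistic solution is exactly the integral of the scattering term, at
  -- most MCη/K ≤ Cη/2; the solution is within twice that.
  obtain ⟨f, hf, hfψ⟩ := exists_isMild_near (h := fun x v => V.indicator (h x) v) hg hm hK hh' hψ hψC (A := C * η / 2) (by positivity)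
    (fun t x v => by
      have hz : IsKernel Ω M (fun (_ : Pos d) (_ _ : Dir d) => (0 : ℝ)) := isKernel_zero hM
      have hi := intervalIntegrable_rate_duhamel hg hz hφ.measurable hφ.bound t x v 0 t
      have hi2 : IntervalIntegrable (fun r => scattering m (fun t x v => V.indicator (φ t x) v) r
          (x - (t - r) • (v : Pos d)) v) volume 0 t :=
        intervalIntegrable_of_exp_bound
          (hsm.comp (f := fun r : ℝ => (r, x - (t - r) • (v : Pos d), v)) (by fun_prop))
          (fun r => hscat _ _ _) _ _
      have hdiff : duhamel m g (fun x v => V.indicator (h x) v) (fun t x v => V.indicator (φ t x) v)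
          t x v - V.indicator (φ t x) v = ∫ r in (0 : ℝ)..t,
            scattering m (fun t x v => V.indicator (φ t x) v) r (x - (t - r) • (v : Pos d)) v := by
        rw [duhamel]
        simp only [hrate]
        by_cases hv : v ∈ V
        · simp only [indicator_of_mem hv]
          rw [intervalIntegral.integral_add hi2 hi, hφ.eq t x v, duhamel]
          ring
        · simp [indicator_of_notMem hv]
      rw [hdiff]
      refine (abs_integral_le_of_exp_bound hK0 (A := M * (C * η)) (by positivity)
        (fun r => hscat _ _ _) t).trans ?_
      refine mul_le_mul_of_nonneg_right ?_ (Real.exp_pos _).le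
      rw [div_le_div_iff₀ hK0 two_pos, hK]
      have : 0 ≤ C * η := by positivity
      nlinarith)
  refine ⟨f, by convert hf using 1; ring, fun t x v => ?_⟩
  convert hfψ t x v using 1
  ring

/-- The Duhamel formula along a characteristic. -/
theorem IsMild.along [NeZero d] (hg : IsLoss Ω L g) (hm : IsKernel Ω M m) {C : ℝ}
    (hf : IsMild m g h K C f) (t : ℝ) (x : Pos d) (v : Dir d) (s : ℝ) :
    f (t + s) (x + s • (v : Pos d)) v =
      f t x v + ∫ r in (0 : ℝ)..s, rate m g f (t + r) (x + r • (v : Pos d)) v := by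
  have hi := intervalIntegrable_rate_duhamel hg hm hf.measurable hf.bound t x v
  rw [hf.eq, hf.eq t x v, duhamel, duhamel]
  have h1 : x + s • (v : Pos d) - (t + s) • (v : Pos d) = x - t • (v : Pos d) := by module
  have h2 : ∀ r, x + s • (v : Pos d) - (t + s - r) • (v : Pos d) = x - (t - r) • (v : Pos d) :=
    fun r => by module
  simp only [h1, h2]
  have h3 := intervalIntegral.integral_comp_add_left (a := 0) (b := s)
    (fun r => rate m g f r (x - (t - r) • (v : Pos d)) v) t
  have h4 : ∀ r, x - (t - (t + r)) • (v : Pos d) = x + r • (v : Pos d) := fun r => by module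
  simp only [h4, add_zero] at h3
  rw [h3, add_assoc, intervalIntegral.integral_add_adjacent_intervals (hi _ _) (hi _ _)]

theorem IsMild.intervalIntegrable [NeZero d] (hg : IsLoss Ω L g) (hm : IsKernel Ω M m) {C : ℝ}
    (hf : IsMild m g h K C f) (t : ℝ) (x : Pos d) (v : Dir d) (a b : ℝ) :
    IntervalIntegrable (fun r => rate m g f (t + r) (x + r • (v : Pos d)) v) volume a b := by
  have h1 := (intervalIntegrable_rate_duhamel hg hm hf.measurable hf.bound t x v
    (t + a) (t + b)).comp_add_left (c := t)
  have h4 : ∀ r, x - (t - (t + r)) • (v : Pos d) = x + r • (v : Pos d) := fun r => by module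
  simpa only [h4, add_sub_cancel_left] using h1

theorem IsMild.continuous_along [NeZero d] (hg : IsLoss Ω L g) (hm : IsKernel Ω M m) {C : ℝ}
    (hf : IsMild m g h K C f) (t : ℝ) (x : Pos d) (v : Dir d) :
    Continuous fun s : ℝ => f (t + s) (x + s • (v : Pos d)) v := by
  simp only [hf.along hg hm t x v]
  exact continuous_const.add
    (intervalIntegral.continuous_primitive (hf.intervalIntegrable hg hm t x v) 0)

end

/-! ### Stationary ballistic solutions -/

section

variable {Ω : Set (Pos d)} {L M K : ℝ} {g : Pos d → Dir d → ℝ → ℝ}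

/-- A solution `B` of the ballistic equation that does not depend on time and takes the value `z`
after leaving `Ω`. -/
structure IsStationary (g : Pos d → Dir d → ℝ → ℝ) (z : ℝ) (B : Pos d → Dir d → ℝ) : Prop where
  measurable : Measurable fun p : Pos d × Dir d => B p.1 p.2
  intervalIntegrable : ∀ x (v : Dir d) a b, IntervalIntegrable
    (fun r : ℝ => g (x + r • (v : Pos d)) v (B (x + r • (v : Pos d)) v)) volume a b
  along : ∀ x (v : Dir d) (s : ℝ), B (x + s • (v : Pos d)) v =
    B x v - ∫ r in (0 : ℝ)..s, g (x + r • (v : Pos d)) v (B (x + r • (v : Pos d)) v)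
  exit : ∀ x (v : Dir d), (∀ r : ℝ, 0 < r → x + r • (v : Pos d) ∉ Ω) → B x v = z

theorem inner_add_smul_dir (x : Pos d) (v : Dir d) (r : ℝ) :
    ⟪x + r • (v : Pos d), (v : Pos d)⟫ = ⟪x, (v : Pos d)⟫ + r := by
  have hv : ‖(v : Pos d)‖ = 1 := norm_eq_of_mem_sphere v
  rw [inner_add_left, real_inner_smul_left, real_inner_self_eq_norm_sq, hv]
  ring

/-- Write B = z + u, where u(x,v) is the integral of g(x + rv, v, z + u) over r > 0. The weight
exp(-K⟨x,v⟩) decays like exp(-Kr) along the ray, so the integral gains 1/K and K = 2(L + 1) gives a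
contraction. On Ω the weight lies between exp(-KR) and exp(KR), whence the factor exp(2KR) in the
bound. -/
theorem exists_isStationary [NeZero d] (hg : IsLoss Ω L g) {R : ℝ} (hR : ∀ x ∈ Ω, ‖x‖ ≤ R) (z : ℝ) :
    ∃ B, IsStationary (Ω := Ω) g z B ∧
      ∀ x ∈ Ω, ∀ v, |B x v| ≤ (1 + 2 * Real.exp (4 * (L + 1) * R)) * |z| := by
  have hL := hg.nonneg
  set K : ℝ := 2 * (L + 1) with hK
  have hK0 : 0 < K := by linarith
  set W : Pos d × Dir d → ℝ := fun p => Real.exp (-K * ⟪p.1, (p.2 : Pos d)⟫) with hW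
  have hWpos : ∀ p, 0 < W p := fun p => Real.exp_pos _
  have hWshift : ∀ (x : Pos d) (v : Dir d) (r : ℝ),
      W (x + r • (v : Pos d), v) = W (x, v) * Real.exp (-K * r) := by
    intro x v r
    simp only [hW]
    rw [inner_add_smul_dir, mul_add, Real.exp_add]
  have hinner : ∀ x ∈ Ω, ∀ v : Dir d, |⟪x, (v : Pos d)⟫| ≤ R := by
    intro x hx v
    have := abs_real_inner_le_norm x (v : Pos d)
    rw [norm_eq_of_mem_sphere v, mul_one] at this
    exact this.trans (hR x hx)
  have hWlower : ∀ x ∈ Ω, ∀ v : Dir d, 1 ≤ Real.exp (K * R) * W (x, v) := by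
    intro x hx v
    simp only [hW]
    rw [← Real.exp_add]
    refine Real.one_le_exp ?_
    have := (abs_le.1 (hinner x hx v)).2
    nlinarith
  have hWupper : ∀ x ∈ Ω, ∀ v : Dir d, W (x, v) ≤ Real.exp (K * R) := by
    intro x hx v
    refine Real.exp_le_exp.2 ?_
    have := (abs_le.1 (hinner x hx v)).1
    nlinarith
  have hgm : ∀ u : Pos d × Dir d → ℝ, Measurable u →
      Measurable fun p : Pos d × Dir d => g p.1 p.2 (z + u p) := fun u hu =>
    hg.measurable.comp (f := fun p : Pos d × Dir d => (p, z + u p)) (by fun_prop)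
  -- The constant z is not dominated by a multiple of the weight on the whole space, but g vanishes
  -- off Ω, and on Ω the weight is at least exp(-KR).
  have hgb : ∀ (u : Pos d × Dir d → ℝ) (C : ℝ), (∀ p, |u p| ≤ C * W p) → ∀ (x : Pos d) (v : Dir d),
      |g x v (z + u (x, v))| ≤ L * (|z| * Real.exp (K * R) + C) * W (x, v) := by
    intro u C hu x v
    have hC : 0 ≤ C * W (x, v) := (abs_nonneg _).trans (hu (x, v))
    by_cases hx : x ∈ Ω
    · calc |g x v (z + u (x, v))| ≤ L * |z + u (x, v)| := hg.abs_le _ _ _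
        _ ≤ L * (|z| + |u (x, v)|) := by gcongr; exact abs_add_le _ _
        _ ≤ L * (|z| * (Real.exp (K * R) * W (x, v)) + C * W (x, v)) := by
          gcongr
          · exact le_mul_of_one_le_right (abs_nonneg _) (hWlower x hx v)
          · exact hu _
        _ = _ := by ring
    · rw [hg.outside x hx, abs_zero]
      have : L * (|z| * Real.exp (K * R) + C) * W (x, v) =
        L * (|z| * Real.exp (K * R) * W (x, v) + C * W (x, v)) := by ring
      rw [this]
      have := (hWpos (x, v)).le
      positivity
  have hline : ∀ (x : Pos d) (v : Dir d), Measurable fun r : ℝ => (x + r • (v : Pos d), v) :=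
    fun x v => by fun_prop
  have hexpint : ∀ D s : ℝ, IntegrableOn (fun r => D * Real.exp (-K * r)) (Ioi s) := fun D s =>
    (integrableOn_exp_mul_Ioi (by linarith) s).const_mul D
  have hint : ∀ (u : Pos d × Dir d → ℝ) (C : ℝ), Measurable u → (∀ p, |u p| ≤ C * W p) →
      ∀ (x : Pos d) (v : Dir d) (s : ℝ), IntegrableOn
        (fun r : ℝ => g (x + r • (v : Pos d)) v (z + u (x + r • (v : Pos d), v))) (Ioi s) := by
    intro u C hu hC x v s
    refine Integrable.mono' (hexpint (L * (|z| * Real.exp (K * R) + C) * W (x, v)) s)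
      ((hgm u hu).comp (hline x v)).aestronglyMeasurable (Eventually.of_forall fun r => ?_)
    calc _ ≤ _ := hgb u C hC (x + r • (v : Pos d)) v
      _ = _ := by rw [hWshift]; ring
  have hexpval : ∀ D : ℝ, ∫ r in Ioi (0 : ℝ), D * Real.exp (-K * r) = D / K := by
    intro D
    rw [integral_const_mul, integral_exp_mul_Ioi (by linarith)]
    simp only [mul_zero, Real.exp_zero]
    field_simp
  have hbound : ∀ (e : ℝ → ℝ) (D : ℝ), (∀ r, |e r| ≤ D * Real.exp (-K * r)) →
      |∫ r in Ioi (0 : ℝ), e r| ≤ D / K := by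
    intro e D he
    rw [← hexpval]
    exact norm_integral_le_of_norm_le (hexpint D 0) (Eventually.of_forall fun r => (Real.norm_eq_abs _).trans_le (he r))
  obtain ⟨u, hum, hu, hΓu⟩ := exists_fixedPoint_near (X := Pos d × Dir d) (W := W)
    (Γ := fun u p => ∫ r in Ioi (0 : ℝ), g (p.1 + r • (p.2 : Pos d)) p.2
      (z + u (p.1 + r • (p.2 : Pos d), p.2)))
    (fun u hu => by
      refine StronglyMeasurable.measurable ?_
      refine StronglyMeasurable.integral_prod_right (f := fun (p : Pos d × Dir d) (r : ℝ) =>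
        g (p.1 + r • (p.2 : Pos d)) p.2 (z + u (p.1 + r • (p.2 : Pos d), p.2))) ?_
      exact ((hgm u hu).comp (f := fun q : (Pos d × Dir d) × ℝ =>
        (q.1.1 + q.2 • (q.1.2 : Pos d), q.1.2)) (by fun_prop)).stronglyMeasurable)
    (by
      rintro u u' A hA hu hu' ⟨C, hC⟩ ⟨C', hC'⟩ huu' ⟨x, v⟩
      simp only
      rw [← integral_sub (hint u C hu hC x v 0) (hint u' C' hu' hC' x v 0)]
      refine (hbound _ (L * A * W (x, v)) fun r => ?_).trans ?_
      · refine (hg.lipschitz _ _ _ _).trans ?_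
        rw [add_sub_add_left_eq_sub]
        calc _ ≤ L * (A * W (x + r • (v : Pos d), v)) := by
              gcongr; exact huu' _
          _ = _ := by rw [hWshift]; ring
      · have := (hWpos (x, v)).le
        rw [div_mul_eq_mul_div, div_le_div_iff₀ hK0 two_pos, hK]
        have : 0 ≤ A * W (x, v) := by positivity
        nlinarith)
    (ψ := fun _ => 0) measurable_const (C := 0) (by simp) (A := |z| * Real.exp (K * R))
    (by positivity)
    (by
      rintro ⟨x, v⟩
      rw [sub_zero]
      refine (hbound _ (L * (|z| * Real.exp (K * R) + 0) * W (x, v)) fun r => ?_).trans ?_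
      · calc _ ≤ _ := hgb (fun _ => 0) 0 (by simp) (x + r • (v : Pos d)) v
          _ = _ := by rw [hWshift]; ring
      · have := (hWpos (x, v)).le
        rw [div_le_iff₀ hK0, hK]
        have : 0 ≤ |z| * Real.exp (2 * (L + 1) * R) * W (x, v) := by positivity
        nlinarith)
  have hu2 : ∀ p, |u p| ≤ 2 * (|z| * Real.exp (K * R)) * W p := fun p => by simpa using hu p
  have hueq : ∀ (x : Pos d) (v : Dir d), u (x, v) =
      ∫ r in Ioi (0 : ℝ), g (x + r • (v : Pos d)) v (z + u (x + r • (v : Pos d), v)) :=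
    fun x v => (congrFun hΓu (x, v)).symm
  have hushift : ∀ (x : Pos d) (v : Dir d) (s : ℝ), u (x + s • (v : Pos d), v) =
      ∫ r in Ioi s, g (x + r • (v : Pos d)) v (z + u (x + r • (v : Pos d), v)) := by
    intro x v s
    rw [hueq]
    have h1 := (measurePreserving_add_right (volume : Measure ℝ) s).setIntegral_preimage_emb
      (measurableEmbedding_addRight s)
      (fun r => g (x + r • (v : Pos d)) v (z + u (x + r • (v : Pos d), v))) (Ioi s)
    have h2 : (fun r : ℝ => r + s) ⁻¹' Ioi s = Ioi 0 := by ext r; simp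
    have h3 : ∀ r : ℝ, x + (r + s) • (v : Pos d) = x + s • (v : Pos d) + r • (v : Pos d) :=
      fun r => by module
    simp only [h2, h3] at h1
    exact h1
  have hI := hint u _ hum hu2
  refine ⟨fun x v => z + u (x, v), ⟨measurable_const.add hum, fun x v a b => ?_, fun x v s => ?_,
    fun x v hx => ?_⟩, fun x hx v => ?_⟩
  · rw [intervalIntegrable_iff]
    exact (hI x v (min a b)).mono_set Ioc_subset_Ioi_self
  · have h1 := hushift x v s
    have h0 := hushift x v 0
    rw [zero_smul, add_zero] at h0
    rw [← intervalIntegral.integral_interval_add_Ioi (hI x v 0) (hI x v s), ← h1] at h0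
    simp only [h0]
    ring
  · rw [hueq, setIntegral_congr_fun (g := fun _ => (0 : ℝ)) measurableSet_Ioi
      fun r hr => hg.outside _ (hx r hr) v _]
    simp
  · calc |z + u (x, v)| ≤ |z| + |u (x, v)| := abs_add_le _ _
      _ ≤ |z| + 2 * (|z| * Real.exp (K * R)) * Real.exp (K * R) := by
        gcongr
        exact (hu2 _).trans (by gcongr; exact hWupper x hx v)
      _ = (1 + 2 * (Real.exp (K * R) * Real.exp (K * R))) * |z| := by ring
      _ = _ := by
        rw [← Real.exp_add, hK]
        ring_nf

theorem IsStationary.continuous_along {z : ℝ} {B : Pos d → Dir d → ℝ}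
    (hB : IsStationary (Ω := Ω) g z B) (x : Pos d) (v : Dir d) :
    Continuous fun s : ℝ => B (x + s • (v : Pos d)) v := by
  rw [show (fun s : ℝ => B (x + s • (v : Pos d)) v) = _ from funext (hB.along x v)]
  exact continuous_const.sub (intervalIntegral.continuous_primitive (hB.intervalIntegrable x v) 0)

/-- Two solutions of the ballistic equation along one characteristic that agree at one point agree
everywhere. -/
theorem eq_of_ballistic (hg : IsLoss Ω L g) {x : Pos d} {v : Dir d} {y y' : ℝ → ℝ}
    (hy : ∀ a b, IntervalIntegrable (fun r : ℝ => g (x + r • (v : Pos d)) v (y r)) volume a b)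
    (hy' : ∀ a b, IntervalIntegrable (fun r : ℝ => g (x + r • (v : Pos d)) v (y' r)) volume a b)
    (hyeq : ∀ s, y s = y 0 - ∫ r in (0 : ℝ)..s, g (x + r • (v : Pos d)) v (y r))
    (hyeq' : ∀ s, y' s = y' 0 - ∫ r in (0 : ℝ)..s, g (x + r • (v : Pos d)) v (y' r))
    {s₀ : ℝ} (h0 : y s₀ = y' s₀) (s : ℝ) : y s = y' s := by
  have key := eq_zero_of_integral_equation (u := fun s => y s - y' s)
    (e := fun r => g (x + r • (v : Pos d)) v (y' r) - g (x + r • (v : Pos d)) v (y r)) (L := L)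
    (s₀ := s₀) (fun a b => (hy' a b).sub (hy a b)) (fun s => ?_) (fun r => ?_)
    (by simpa using sub_eq_zero.2 h0) s
  · exact sub_eq_zero.1 key
  · rw [intervalIntegral.integral_sub (hy' _ _) (hy _ _),
      ← intervalIntegral.integral_interval_sub_left (hy' 0 s) (hy' 0 s₀),
      ← intervalIntegral.integral_interval_sub_left (hy 0 s) (hy 0 s₀), hyeq s, hyeq' s, hyeq s₀,
      hyeq' s₀]
    ring
  · rw [abs_sub_comm (y r)]
    exact hg.lipschitz _ _ _ _

theorem IsStationary.eq_of_exit_eq {z : ℝ} {B : Pos d → Dir d → ℝ} (hg : IsLoss Ω L g)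
    (hB : IsStationary (Ω := Ω) g z B) {x : Pos d} {v : Dir d} {y : ℝ → ℝ}
    (hy : ∀ a b, IntervalIntegrable (fun r : ℝ => g (x + r • (v : Pos d)) v (y r)) volume a b)
    (hyeq : ∀ s, y s = y 0 - ∫ r in (0 : ℝ)..s, g (x + r • (v : Pos d)) v (y r)) {s₀ : ℝ}
    (h0 : y s₀ = B (x + s₀ • (v : Pos d)) v) (s : ℝ) : y s = B (x + s • (v : Pos d)) v :=
  eq_of_ballistic hg hy (hB.intervalIntegrable x v) hyeq
    (fun s => by simpa using hB.along x v s) h0 s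

/-- A stationary solution with nonzero exit value vanishes nowhere in a bounded `Ω`. -/
theorem IsStationary.ne_zero {z : ℝ} {B : Pos d → Dir d → ℝ} (hg : IsLoss Ω L g)
    (hB : IsStationary (Ω := Ω) g z B) (hz : z ≠ 0) {x : Pos d} {v : Dir d} {τ : ℝ}
    (hτ : ∀ r : ℝ, τ < r → x + r • (v : Pos d) ∉ Ω) : B x v ≠ 0 := by
  intro h0
  -- The zero function solves the ballistic equation, so one zero of B on the line would force B = 0
  -- at the exit, where B = z.
  have h1 := hB.eq_of_exit_eq hg (x := x) (v := v) (y := fun _ => 0) (s₀ := 0)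
    (fun a b => by simp [hg.zero]) (fun s => by simp [hg.zero]) (by simpa using h0.symm) τ
  have h2 := hB.exit (x + τ • (v : Pos d)) v fun r hr => by
    have := hτ (τ + r) (by linarith)
    rwa [add_smul, ← add_assoc] at this
  exact hz (h2.symm.trans h1.symm)

end

/-! ### Coefficients defined everywhere -/

section

variable {Ω : Set (Pos d)}

/-- An essentially bounded function has a measurable representative with the same bound
everywhere. -/
theorem exists_measurable_bounded_rep {X : Type*} [MeasurableSpace X] {ν : Measure X} {F : X → ℝ}
    (hF : MemLp F ∞ ν) {s : Set X} (hs : MeasurableSet s) (hsν : ∀ᵐ p ∂ν, p ∈ s) :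
    ∃ F', Measurable F' ∧ (∀ p, |F' p| ≤ (eLpNorm F ∞ ν).toReal) ∧ (∀ p ∉ s, F' p = 0) ∧
      ∀ᵐ p ∂ν, F' p = F p := by
  set c := (eLpNorm F ∞ ν).toReal
  have hmk : Measurable (hF.1.mk F) := hF.1.stronglyMeasurable_mk.measurable
  -- Cutting the representative to zero where it exceeds its essential bound makes the bound hold
  -- everywhere.
  set S : Set X := s ∩ {p | |hF.1.mk F p| ≤ c} with hS
  have hSm : MeasurableSet S := hs.inter (measurableSet_le hmk.abs measurable_const)
  have hb : ∀ᵐ p ∂ν, |F p| ≤ c := by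
    have h1 := ae_le_eLpNormEssSup (f := F) (μ := ν)
    filter_upwards [h1] with p hp
    rw [← eLpNorm_exponent_top] at hp
    have := ENNReal.toReal_mono hF.2.ne hp
    rwa [toReal_enorm] at this
  refine ⟨S.indicator (hF.1.mk F), hmk.indicator hSm, fun p => ?_, fun p hp => ?_, ?_⟩
  · by_cases hp : p ∈ S
    · rw [indicator_of_mem hp]; exact hp.2
    · rw [indicator_of_notMem hp, abs_zero]; exact ENNReal.toReal_nonneg
  · exact indicator_of_notMem (fun h => hp h.1) _
  · filter_upwards [hF.1.ae_eq_mk, hb, hsν] with p h1 h2 h3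
    rw [indicator_of_mem, h1]
    exact ⟨h3, by change |hF.1.mk F p| ≤ c; rwa [← h1]⟩

theorem ae_phase_mem (hΩ : MeasurableSet Ω) : ∀ᵐ p ∂(phaseMeasure Ω), p.1 ∈ Ω :=
  Measure.quasiMeasurePreserving_fst.ae (ae_restrict_mem hΩ)

theorem ae_phase_iff [NeZero d] (hΩ : MeasurableSet Ω) {P : Pos d × Dir d → Prop} :
    (∀ᵐ p ∂(phaseMeasure Ω), P p) ↔
      ∀ᵐ p ∂((volume : Measure (Pos d)).prod (sphereMeasure d)), p.1 ∈ Ω → P p := by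
  have h : phaseMeasure Ω = ((volume : Measure (Pos d)).prod (sphereMeasure d)).restrict
      (Prod.fst ⁻¹' Ω) := by
    have := Measure.prod_restrict (μ := (volume : Measure (Pos d))) (ν := sphereMeasure d) Ω univ
    rwa [Measure.restrict_univ, prod_univ] at this
  rw [h, ae_restrict_iff' (measurable_fst hΩ)]
  rfl

theorem exists_kernel_rep [NeZero d] (hΩ : MeasurableSet Ω) {μ : Pos d → Dir d → Dir d → ℝ}
    (hμ : MemLp (fun p : Pos d × Dir d × Dir d => μ p.1 p.2.1 p.2.2) ∞ (phaseMeasure₂ Ω)) :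
    ∃ M m, IsKernel Ω M m ∧
      ∀ᵐ p ∂(phaseMeasure Ω), ∀ᵐ v' ∂(sphereMeasure d), m p.1 v' p.2 = μ p.1 v' p.2 := by
  obtain ⟨F, hFm, hFb, hFs, hFμ⟩ := exists_measurable_bounded_rep hμ (measurable_fst hΩ)
    (Measure.quasiMeasurePreserving_fst.ae (ae_restrict_mem hΩ))
  refine ⟨_, fun x v' v => F (x, v', v), ⟨hFm, fun x v' v => hFb _, fun x hx v' v => hFs _ hx⟩, ?_⟩
  have hmp : MeasurePreserving (fun q : (Pos d × Dir d) × Dir d => (q.1.1, q.2, q.1.2))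
      ((phaseMeasure Ω).prod (sphereMeasure d)) (phaseMeasure₂ Ω) := by
    have h1 := measurePreserving_prodAssoc ((volume : Measure (Pos d)).restrict Ω) (sphereMeasure d)
      (sphereMeasure d)
    have h2 := (MeasurePreserving.id ((volume : Measure (Pos d)).restrict Ω)).prod
      (Measure.measurePreserving_swap (μ := sphereMeasure d) (ν := sphereMeasure d))
    exact h2.comp h1
  exact Measure.ae_ae_of_ae_prod (hmp.quasiMeasurePreserving.ae hFμ)

/-- The truncation of a real number to `[-ρ, ρ]`. -/
def clamp (ρ z : ℝ) : ℝ := max (-ρ) (min z ρ)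

theorem abs_clamp_sub_clamp_le (ρ z z' : ℝ) : |clamp ρ z - clamp ρ z'| ≤ |z - z'| := by
  rw [clamp, clamp, max_comm, max_comm (-ρ)]
  refine (abs_max_sub_max_le_abs _ _ _).trans ((abs_min_sub_min_le_max _ _ _ _).trans ?_)
  simp

theorem abs_clamp_le {ρ : ℝ} (hρ : 0 ≤ ρ) (z : ℝ) : |clamp ρ z| ≤ ρ :=
  abs_le.2 ⟨le_max_left _ _, max_le (by linarith) (min_le_right _ _)⟩

theorem clamp_of_abs_le {ρ z : ℝ} (hz : |z| ≤ ρ) : clamp ρ z = z := by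
  rw [clamp, min_eq_left (abs_le.1 hz).2, max_eq_right (abs_le.1 hz).1]

/-- Truncating z at half the radius of the series at 0 makes the loss globally Lipschitz without
changing it for small z. -/
theorem exists_loss_rep [NeZero d] (hΩ : MeasurableSet Ω) {σ : Pos d → Dir d → ℝ}
    {N : Pos d → Dir d → ℝ → ℝ}
    (hσ : MemLp (fun p : Pos d × Dir d => σ p.1 p.2) ∞ (phaseMeasure Ω)) (hN : IsNonlinearity Ω N) :
    ∃ L ρ g, 0 < ρ ∧ IsLoss Ω L g ∧
      ∀ᵐ p ∂(phaseMeasure Ω), ∀ z, |z| ≤ ρ → g p.1 p.2 z = σ p.1 p.2 * z + N p.1 p.2 z := by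
  obtain ⟨r, hr, a, ha, hsum, hNa⟩ := hN.analytic 0
  have hΩ' : MeasurableSet (Prod.fst ⁻¹' Ω : Set (Pos d × Dir d)) := measurable_fst hΩ
  obtain ⟨s, hsm, hsb, hsΩ, hsσ⟩ := exists_measurable_bounded_rep hσ hΩ' (ae_phase_mem hΩ)
  have hrep := fun k => exists_measurable_bounded_rep (ha k) hΩ' (ae_phase_mem hΩ)
  choose A hAm hAb hAΩ hAa using hrep
  set S := (eLpNorm (fun p : Pos d × Dir d => σ p.1 p.2) ∞ (phaseMeasure Ω)).toReal
  set c : ℕ → ℝ := fun k =>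
    (eLpNorm (fun p : Pos d × Dir d => a k p.1 p.2) ∞ (phaseMeasure Ω)).toReal with hc
  have hc0 : ∀ k, 0 ≤ c k := fun k => ENNReal.toReal_nonneg
  set ρ := r / 2 with hρ
  have hρ0 : 0 < ρ := by positivity
  have hclampm : Measurable (clamp ρ) := by unfold clamp; fun_prop
  have hsum1 : Summable fun k => c (k + 1) * r ^ (k + 1) := (summable_nat_add_iff 1).2 hsum
  -- With ρ = r/2 the majorant (k + 1)ρ^k of the differentiated series is at most r^k, because k + 1
  -- ≤ 2^k.
  have hsum2 : Summable fun k => c (k + 1) * ((k + 1 : ℕ) * ρ ^ k) := by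
    refine Summable.of_nonneg_of_le (fun k => by have := hc0 (k + 1); positivity) (fun k => ?_)
      (hsum1.mul_right r⁻¹)
    rw [mul_assoc, pow_succ, mul_assoc, mul_inv_cancel₀ hr.ne', mul_one]
    refine mul_le_mul_of_nonneg_left ?_ (hc0 _)
    have h2 : ((k + 1 : ℕ) : ℝ) ≤ 2 ^ k := by exact_mod_cast Nat.lt_two_pow_self
    calc ((k + 1 : ℕ) : ℝ) * ρ ^ k ≤ 2 ^ k * ρ ^ k := by gcongr
      _ = r ^ k := by rw [← mul_pow, hρ]; ring_nf
  have hterm : ∀ p z k, |A (k + 1) p * clamp ρ z ^ (k + 1)| ≤ c (k + 1) * r ^ (k + 1) := by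
    intro p z k
    rw [abs_mul, abs_pow]
    have h1 := abs_clamp_le hρ0.le z
    have h2 : ρ ≤ r := by rw [hρ]; linarith
    exact mul_le_mul (hAb _ _) (pow_le_pow_left₀ (abs_nonneg _) (h1.trans h2) _) (by positivity)
      (hc0 _)
  have hsummable : ∀ p z, Summable fun k => A (k + 1) p * clamp ρ z ^ (k + 1) := fun p z =>
    Summable.of_norm_bounded hsum1 (hterm p z)
  set g : Pos d → Dir d → ℝ → ℝ := fun x v z =>
    s (x, v) * clamp ρ z + ∑' k, A (k + 1) (x, v) * clamp ρ z ^ (k + 1) with hg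
  refine ⟨S + ∑' k, c (k + 1) * ((k + 1 : ℕ) * ρ ^ k), ρ, g, hρ0, ⟨?_, ?_, ?_, ?_⟩, ?_⟩
  · refine Measurable.add ((hsm.comp measurable_fst).mul (hclampm.comp measurable_snd)) ?_
    refine measurable_of_tendsto_metrizable (f := fun n (q : (Pos d × Dir d) × ℝ) =>
      ∑ k ∈ Finset.range n, A (k + 1) q.1 * clamp ρ q.2 ^ (k + 1)) (fun n => ?_)
      (tendsto_pi_nhds.2 fun q => (hsummable q.1 q.2).hasSum.tendsto_sum_nat)
    exact Finset.measurable_sum _ fun k _ =>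
      ((hAm _).comp measurable_fst).mul ((hclampm.comp measurable_snd).pow_const _)
  · intro x v z z'
    have hcl := abs_clamp_sub_clamp_le ρ z z'
    have h1 : |s (x, v) * clamp ρ z - s (x, v) * clamp ρ z'| ≤ S * |z - z'| := by
      rw [← mul_sub, abs_mul]
      exact mul_le_mul (hsb _) hcl (abs_nonneg _) ((abs_nonneg _).trans (hsb (x, v)))
    have h2 : |∑' k, A (k + 1) (x, v) * clamp ρ z ^ (k + 1) -
        ∑' k, A (k + 1) (x, v) * clamp ρ z' ^ (k + 1)| ≤
        (∑' k, c (k + 1) * ((k + 1 : ℕ) * ρ ^ k)) * |z - z'| := by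
      rw [← (hsummable (x, v) z).tsum_sub (hsummable (x, v) z')]
      rw [← Real.norm_eq_abs]
      refine tsum_of_norm_bounded (hsum2.hasSum.mul_right |z - z'|) fun k => ?_
      rw [← mul_sub, norm_mul, mul_assoc]
      refine mul_le_mul (hAb _ _) ?_ (norm_nonneg _) (hc0 _)
      refine (abs_pow_sub_pow_le _ _ _).trans ?_
      rw [Nat.add_sub_cancel, mul_assoc, mul_comm]
      refine mul_le_mul ?_ hcl (abs_nonneg _) (by positivity)
      gcongr
      exact max_le (abs_clamp_le hρ0.le z) (abs_clamp_le hρ0.le z')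
    calc |g x v z - g x v z'| = |(s (x, v) * clamp ρ z - s (x, v) * clamp ρ z') +
          (∑' k, A (k + 1) (x, v) * clamp ρ z ^ (k + 1) -
            ∑' k, A (k + 1) (x, v) * clamp ρ z' ^ (k + 1))| := by
          simp only [hg]; ring_nf
      _ ≤ _ := abs_add_le _ _
      _ ≤ _ := add_le_add h1 h2
      _ = _ := by ring
  · intro x v
    simp [hg, clamp_of_abs_le (show |(0 : ℝ)| ≤ ρ by simpa using hρ0.le)]
  · intro x hx v z
    simp [hg, hsΩ (x, v) hx, hAΩ _ (x, v) hx]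
  · filter_upwards [hsσ, ae_all_iff.2 hAa, hNa, hN.zero] with p h1 h2 h3 h4 z hz
    -- N vanishes at 0, so the series starts at index 1, matching the shifted sum in the definition
    -- of g.
    have ha0 : a 0 p.1 p.2 = 0 := by
      have h5 := h3 0 (by simpa using hr)
      have h6 : HasSum (fun k => a k p.1 p.2 * ((0 : ℝ) - 0) ^ k) (a 0 p.1 p.2) := by
        convert hasSum_single (f := fun k => a k p.1 p.2 * ((0 : ℝ) - 0) ^ k) 0 fun k hk => ?_ using 1
        · simp
        · simp [hk]
      rw [h6.unique h5, h4]
    have h5 := h3 z (by rw [sub_zero]; linarith)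
    rw [sub_zero, ← hasSum_nat_add_iff' 1] at h5
    simp only [Finset.sum_range_one, pow_zero, mul_one, ha0, sub_zero] at h5
    simp only [hg, clamp_of_abs_le hz, h2]
    rw [h5.tsum_eq, h1]

end

/-! ### Convex geometry and realization of the measurement -/

section

variable {Ω : Set (Pos d)}

/-- For a convex open set, the gradient of a local defining function is a strict supporting
normal. -/
theorem IsLocalDefiningFunction.inner_neg (hΩo : IsOpen Ω) (hΩc : Convex ℝ Ω) {y : Pos d}
    (hy : y ∈ frontier Ω) {U : Set (Pos d)} {ρ : Pos d → ℝ} (hρ : IsLocalDefiningFunction Ω y U ρ)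
    {z : Pos d} (hz : z ∈ Ω) : ⟪gradient ρ y, z - y⟫ < 0 := by
  have hycl : y ∈ closure Ω := frontier_subset_closure hy
  have hyΩ : y ∉ Ω := by
    rw [hΩo.frontier_eq] at hy
    exact hy.2
  have hUn : U ∈ 𝓝 y := hρ.isOpen.mem_nhds hρ.mem
  have hdiff : DifferentiableAt ℝ ρ y :=
    (hρ.smooth.contDiffAt hUn).differentiableAt (by simp)
  have hy0 : 0 ≤ ρ y := by
    by_contra hneg
    have : y ∈ {z ∈ U | ρ z < 0} := ⟨hρ.mem, not_le.1 hneg⟩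
    rw [← hρ.inter_eq] at this
    exact hyΩ this.1
  -- The segment from y towards z enters Ω at once, where ρ < 0 ≤ ρ(y), so the one-sided derivative
  -- is nonpositive.
  have weak : ∀ z ∈ Ω, ⟪gradient ρ y, z - y⟫ ≤ 0 := by
    intro z hz
    have hline : HasDerivAt (fun s : ℝ => ρ (y + s • (z - y))) ⟪gradient ρ y, z - y⟫ 0 := by
      have h1 : HasDerivAt (fun s : ℝ => y + s • (z - y)) (z - y) 0 := by
        simpa using ((hasDerivAt_id (0 : ℝ)).smul_const (z - y)).const_add y
      have h2 : HasFDerivAt ρ (innerSL ℝ (gradient ρ y)) (y + (0 : ℝ) • (z - y)) := by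
        rw [zero_smul, add_zero]
        exact hdiff.hasGradientAt.hasFDerivAt
      exact h2.comp_hasDerivAt (0 : ℝ) h1
    have hU : ∀ᶠ s in 𝓝[>] (0 : ℝ), y + s • (z - y) ∈ U := by
      have hc : ContinuousAt (fun s : ℝ => y + s • (z - y)) 0 := by fun_prop
      have : U ∈ 𝓝 (y + (0 : ℝ) • (z - y)) := by simpa using hUn
      exact (hc.eventually this).filter_mono nhdsWithin_le_nhds
    have hneg : ∀ᶠ s in 𝓝[>] (0 : ℝ), ρ (y + s • (z - y)) - ρ y ≤ 0 := by
      filter_upwards [hU, Ioo_mem_nhdsGT (show (0 : ℝ) < 1 by norm_num)] with s hs hs1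
      have hmem : y + s • (z - y) ∈ Ω := by
        have := hΩc.combo_closure_interior_mem_interior hycl (hΩo.interior_eq.symm ▸ hz)
          (a := 1 - s) (b := s) (by linarith [hs1.2]) hs1.1 (by ring)
        rw [hΩo.interior_eq] at this
        convert this using 1
        module
      have : y + s • (z - y) ∈ {z ∈ U | ρ z < 0} := by
        rw [← hρ.inter_eq]; exact ⟨hmem, hs⟩
      linarith [this.2]
    have hslope := (hasDerivAt_iff_tendsto_slope.1 hline).mono_left
      (nhdsWithin_mono (0 : ℝ) (show Ioi (0 : ℝ) ⊆ {0}ᶜ from fun s hs => ne_of_gt hs))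
    refine le_of_tendsto hslope ?_
    filter_upwards [hneg, self_mem_nhdsWithin] with s hs hs0
    rw [slope_def_field]
    have hs0' : (0 : ℝ) < s := hs0
    simp only [zero_smul, add_zero, sub_zero]
    exact div_nonpos_of_nonpos_of_nonneg hs hs0'.le
  -- Strictness comes from openness: the weak inequality also holds at z moved slightly along the
  -- gradient.
  have hc : ContinuousAt (fun s : ℝ => z + s • gradient ρ y) 0 := by fun_prop
  have hev : ∀ᶠ s in 𝓝[>] (0 : ℝ), z + s • gradient ρ y ∈ Ω := by
    have : Ω ∈ 𝓝 (z + (0 : ℝ) • gradient ρ y) := by simpa using hΩo.mem_nhds hz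
    exact (hc.eventually this).filter_mono nhdsWithin_le_nhds
  obtain ⟨s, hs, hs0⟩ := (hev.and self_mem_nhdsWithin).exists
  have h1 := weak _ hs
  have h2 : z + s • gradient ρ y - y = (z - y) + s • gradient ρ y := by abel
  rw [h2, inner_add_right, real_inner_smul_right, real_inner_self_eq_norm_sq] at h1
  have hn : 0 < ‖gradient ρ y‖ := norm_pos_iff.2 hρ.gradient_ne_zero
  have hs0' : (0 : ℝ) < s := hs0
  have : 0 < s * ‖gradient ρ y‖ ^ 2 := by positivity
  linarith

theorem IsOuterUnitNormal.inner_neg (hΩo : IsOpen Ω) (hΩc : Convex ℝ Ω) {y n : Pos d}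
    (hy : y ∈ frontier Ω) (hn : IsOuterUnitNormal Ω y n) {z : Pos d} (hz : z ∈ Ω) :
    ⟪n, z - y⟫ < 0 := by
  obtain ⟨U, ρ, hρ, rfl⟩ := hn
  rw [real_inner_smul_left]
  exact mul_neg_of_pos_of_neg (inv_pos.2 (norm_pos_iff.2 hρ.gradient_ne_zero))
    (hρ.inner_neg hΩo hΩc hy hz)

theorem IsOuterUnitNormal.norm_eq {y n : Pos d} (hn : IsOuterUnitNormal Ω y n) : ‖n‖ = 1 := by
  obtain ⟨U, ρ, hρ, rfl⟩ := hn
  rw [norm_smul, norm_inv, norm_norm, inv_mul_cancel₀ (norm_ne_zero_iff.2 hρ.gradient_ne_zero)]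

theorem HasSmoothBoundary.exists_normal (hΩs : HasSmoothBoundary Ω) {y : Pos d}
    (hy : y ∈ frontier Ω) : ∃ n, IsOuterUnitNormal Ω y n := by
  obtain ⟨U, ρ, hρ⟩ := hΩs y hy
  exact ⟨_, U, ρ, hρ, rfl⟩

theorem notMem_of_incoming (hΩo : IsOpen Ω) (hΩc : Convex ℝ Ω) {y : Pos d} {v : Dir d}
    (h : (y, v) ∈ incoming Ω) {t : ℝ} (ht : 0 ≤ t) : y - t • (v : Pos d) ∉ Ω := by
  obtain ⟨hy, n, hn, hnv⟩ := h
  intro hmem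
  have h1 := hn.inner_neg hΩo hΩc hy hmem
  have h2 : y - t • (v : Pos d) - y = (-t) • (v : Pos d) := by module
  rw [h2, real_inner_smul_right] at h1
  change ⟪n, (v : Pos d)⟫ < 0 at hnv
  nlinarith

variable {L M K C T ρ : ℝ} {g : Pos d → Dir d → ℝ → ℝ} {m : Pos d → Dir d → Dir d → ℝ}
  {h : Pos d → Dir d → ℝ} {f : ℝ → Pos d → Dir d → ℝ}

theorem IsMild.initial (hf : IsMild m g h K C f) (x : Pos d) (v : Dir d) : f 0 x v = h x v := by
  rw [hf.eq, duhamel]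
  simp

theorem ae_timePhase_of_ae [NeZero d] {P : Pos d × Dir d → Prop}
    (hP : ∀ᵐ p ∂((volume : Measure (Pos d)).prod (sphereMeasure d)), P p) :
    ∀ᵐ w ∂(timePhaseMeasure Ω T), P w.2 := by
  have h1 : ∀ᵐ p ∂(phaseMeasure Ω), P p :=
    (Measure.AbsolutelyContinuous.prod Measure.restrict_le_self.absolutelyContinuous
      Measure.AbsolutelyContinuous.rfl).ae_le hP
  have : SFinite (phaseMeasure Ω) := by unfold phaseMeasure; infer_instance
  exact Measure.quasiMeasurePreserving_snd.ae h1

/-- A small solution in the whole space whose initial data are supported in `Ω` realizes the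
measurement. -/
theorem IsMild.isMeasurement [NeZero d] (hΩo : IsOpen Ω) (hΩc : Convex ℝ Ω)
    {σ : Pos d → Dir d → ℝ} {μ : Pos d → Dir d → Dir d → ℝ} {N : Pos d → Dir d → ℝ → ℝ}
    (hg : IsLoss Ω L g) (hm : IsKernel Ω M m)
    (hmμ : ∀ᵐ p ∂(phaseMeasure Ω), ∀ᵐ v' ∂(sphereMeasure d), m p.1 v' p.2 = μ p.1 v' p.2)
    (hgN : ∀ᵐ p ∂(phaseMeasure Ω), ∀ z, |z| ≤ ρ → g p.1 p.2 z = σ p.1 p.2 * z + N p.1 p.2 z)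
    (hf : IsMild m g h K C f) (hh : ∀ x ∉ Ω, ∀ v, h x v = 0)
    (hfρ : ∀ t ∈ Ioo 0 T, ∀ x v, |f t x v| ≤ ρ) :
    IsMeasurement Ω T σ μ N h (fun _ _ _ => 0) f := by
  have hcont := hf.continuous_along hg hm
  refine ⟨f, ⟨?_, ?_, ?_, ?_⟩, ?_⟩
  · refine memLp_top_of_bound hf.measurable.aestronglyMeasurable ρ ?_
    have : ∀ᵐ w ∂(timePhaseMeasure Ω T), w.1 ∈ Ioo 0 T :=
      Measure.quasiMeasurePreserving_fst.ae (ae_restrict_mem measurableSet_Ioo)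
    filter_upwards [this] with w hw
    exact hfρ _ hw _ _
  · have h1 := ae_line_of_ae (P := fun x v => x ∈ Ω →
      ((∀ᵐ v' ∂(sphereMeasure d), m x v' v = μ x v' v) ∧
        ∀ z, |z| ≤ ρ → g x v z = σ x v * z + N x v z))
      ((ae_phase_iff hΩo.measurableSet (P := fun p =>
        ((∀ᵐ v' ∂(sphereMeasure d), m p.1 v' p.2 = μ p.1 v' p.2) ∧
        ∀ z, |z| ≤ ρ → g p.1 p.2 z = σ p.1 p.2 * z + N p.1 p.2 z))).1 (hmμ.and hgN))
    have h2 : ∀ᵐ w ∂(timePhaseMeasure Ω T), w.1 ∈ Ioo 0 T ∧ w.2.1 ∈ Ω := by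
      refine (Measure.quasiMeasurePreserving_fst.ae (ae_restrict_mem measurableSet_Ioo)).and ?_
      have : SFinite (phaseMeasure Ω) := by unfold phaseMeasure; infer_instance
      exact Measure.quasiMeasurePreserving_snd.ae (ae_phase_mem hΩo.measurableSet)
    filter_upwards [ae_timePhase_of_ae h1, h2] with w hw hw2 s hs hsΩ
    obtain ⟨t, x, v⟩ := w
    simp only at hw hw2 hs hsΩ ⊢
    -- By convexity the characteristic stays in (0,T) × Ω between its endpoints, where f is bounded
    -- by ρ and the modified coefficients agree with the original ones almost everywhere on the
    -- line.
    have hseg : ∀ r ∈ uIoc 0 s, t + r ∈ Ioo 0 T ∧ x + r • (v : Pos d) ∈ Ω := by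
      intro r hr
      have hr' : r ∈ segment ℝ 0 s := by rw [segment_eq_uIcc]; exact uIoc_subset_uIcc hr
      obtain ⟨a, b, ha, hb, hab, rfl⟩ := hr'
      have e1 : t + (a • 0 + b • s) = a • t + b • (t + s) := by
        simp only [smul_eq_mul]; linear_combination (-t) * hab
      have e2 : x + (a • 0 + b • s) • (v : Pos d) = a • x + b • (x + s • (v : Pos d)) := by
        have ha' : a = 1 - b := by linarith
        subst ha'
        simp only [smul_eq_mul]
        module
      rw [e1, e2]
      exact ⟨convex_Ioo 0 T hw2.1 hs ha hb hab, hΩc hw2.2 hsΩ ha hb hab⟩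
    have heq : ∀ᵐ r : ℝ, r ∈ uIoc 0 s → rate m g f (t + r) (x + r • (v : Pos d)) v =
        transportRHS σ μ N f (t + r) (x + r • (v : Pos d)) v := by
      filter_upwards [hw] with r hr hrs
      obtain ⟨ht, hx⟩ := hseg r hrs
      obtain ⟨hr1, hr2⟩ := hr hx
      rw [rate, transportRHS, hr2 _ (hfρ _ ht _ _), ← sub_sub]
      congr 2
      refine integral_congr_ae ?_
      filter_upwards [hr1] with v' hv'
      rw [hv']
    refine ⟨(hf.intervalIntegrable hg hm t x v 0 s).congr_ae
      ((ae_restrict_iff' measurableSet_uIoc).2 heq), ?_⟩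
    rw [hf.along hg hm t x v s, intervalIntegral.integral_congr_ae heq]
  · refine Eventually.of_forall fun p => ?_
    have h1 := (hcont 0 p.1 p.2).tendsto 0
    simp only [zero_add, zero_smul, add_zero, hf.initial] at h1
    exact h1.mono_left nhdsWithin_le_nhds
  · have h2 : ∀ᵐ w ∂(boundaryMeasure Ω T), w.1 ∈ Ioo 0 T :=
      Measure.quasiMeasurePreserving_fst.ae (ae_restrict_mem measurableSet_Ioo)
    filter_upwards [h2] with w hw hin
    obtain ⟨t, y, v⟩ := w
    simp only at hw hin ⊢
    have h1 := (hcont t y v).tendsto 0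
    have h0 : f t y v = 0 := by
      -- Traced backwards, an incoming ray never meets Ω, so it carries neither data nor sources.
      have hout : ∀ r ∈ Icc 0 t, y - r • (v : Pos d) ∉ Ω := fun r hr =>
        notMem_of_incoming hΩo hΩc hin hr.1
      rw [hf.eq, duhamel, hh _ (hout t ⟨hw.1.le, le_rfl⟩), zero_add,
        intervalIntegral.integral_congr (g := fun _ => (0 : ℝ)) fun r hr => ?_]
      · simp
      · rw [uIcc_of_le hw.1.le] at hr
        exact rate_outside hg hm (hout (t - r) ⟨by linarith [hr.2], by linarith [hr.1]⟩) r v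
    simp only [zero_smul, add_zero, h0] at h1
    exact h1.mono_left nhdsWithin_le_nhds
  · refine Eventually.of_forall fun w _ => ?_
    have h1 := ((hcont w.1 w.2.1 w.2.2).comp continuous_neg).tendsto 0
    simp only [Function.comp_def, neg_zero, zero_smul, add_zero, neg_smul, ← sub_eq_add_neg] at h1
    exact h1.mono_left nhdsWithin_le_nhds

end

/-! ### Surface measure and exit points -/

section

variable {Ω : Set (Pos d)}

/-- The hyperplane has dimension d - 1, and Hausdorff measure in the dimension of the space is Haar.
This gives finiteness on bounded sets and access to Fubini across parallel lines. -/
theorem isAddHaarMeasure_hausdorff_hyperplane [NeZero d] {n : Pos d} (hn : ‖n‖ = 1) :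
    (μH[(d : ℝ) - 1] : Measure ((ℝ ∙ n)ᗮ : Submodule ℝ (Pos d))).IsAddHaarMeasure := by
  obtain ⟨k, rfl⟩ := Nat.exists_eq_add_one_of_ne_zero (NeZero.ne d)
  have : Fact (Module.finrank ℝ (Pos (k + 1)) = k + 1) := ⟨finrank_euclideanSpace_fin⟩
  have hn0 : n ≠ 0 := by
    rintro rfl
    simp at hn
  have h1 : Module.finrank ℝ ((ℝ ∙ n)ᗮ : Submodule ℝ (Pos (k + 1))) = k :=
    Submodule.finrank_orthogonal_span_singleton hn0
  have h2 := isAddHaarMeasure_hausdorffMeasure (E := ((ℝ ∙ n)ᗮ : Submodule ℝ (Pos (k + 1))))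
  rw [h1] at h2
  have e : ((k + 1 : ℕ) : ℝ) - 1 = k := by push_cast; ring
  rw [e]
  exact h2

theorem norm_sq_eq_inner_sq_add {n : Pos d} (hn : ‖n‖ = 1) (w : Pos d) :
    ‖w‖ ^ 2 = ⟪n, w⟫ ^ 2 + ‖(ℝ ∙ n)ᗮ.orthogonalProjectionOnto w‖ ^ 2 := by
  rw [Submodule.norm_sq_eq_add_norm_sq_projection w (ℝ ∙ n)]
  congr 1
  have h1 : ‖(ℝ ∙ n).orthogonalProjectionOnto w‖ = ‖(ℝ ∙ n).starProjection w‖ := rfl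
  rw [h1, Submodule.starProjection_unit_singleton ℝ hn, norm_smul, hn, mul_one, Real.norm_eq_abs,
    sq_abs]

/-- The surface measure of the part of the boundary of a convex set whose normals are close to a
given direction is finite. -/
theorem hausdorffMeasure_frontier_near_lt_top [NeZero d] (hΩo : IsOpen Ω)
    (hΩb : Bornology.IsBounded Ω) (hΩc : Convex ℝ Ω) {n₀ : Pos d} (hn₀ : ‖n₀‖ = 1) :
    μH[(d : ℝ) - 1] {y ∈ frontier Ω | ∃ n, IsOuterUnitNormal Ω y n ∧ ‖n₀ - n‖ ≤ 1 / 2} < ⊤ := by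
  set S := {y ∈ frontier Ω | ∃ n, IsOuterUnitNormal Ω y n ∧ ‖n₀ - n‖ ≤ 1 / 2} with hS
  set P := (ℝ ∙ n₀)ᗮ.orthogonalProjectionOnto with hP
  have hd : (0 : ℝ) ≤ (d : ℝ) - 1 := by
    have : (1 : ℝ) ≤ d := by exact_mod_cast Nat.one_le_iff_ne_zero.2 (NeZero.ne d)
    linarith
  have hone : ∀ y ∈ S, ∀ y' ∈ S, ⟪n₀, y' - y⟫ ≤ 1 / 2 * ‖y' - y‖ := by
    rintro y ⟨hy, n, hn, hnn⟩ y' ⟨hy', -⟩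
    have hle : ⟪n, y' - y⟫ ≤ 0 := by
      have hcl : IsClosed {z : Pos d | ⟪n, z - y⟫ ≤ 0} :=
        isClosed_le (by fun_prop) continuous_const
      exact closure_minimal (fun z hz => (hn.inner_neg hΩo hΩc hy hz).le) hcl
        (frontier_subset_closure hy')
    calc ⟪n₀, y' - y⟫ = ⟪n₀ - n, y' - y⟫ + ⟪n, y' - y⟫ := by rw [inner_sub_left]; ring
      _ ≤ ‖n₀ - n‖ * ‖y' - y‖ + 0 := add_le_add (real_inner_le_norm _ _) hle
      _ ≤ 1 / 2 * ‖y' - y‖ := by rw [add_zero]; gcongr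
  -- By convexity |⟨n₀,w⟩| ≤ |w|/2 for chords w of this piece, hence |Pw|² ≥ (3/4)|w|²: the piece is
  -- a Lipschitz graph over the hyperplane, and the constant 2 is not sharp.
  have hanti : AntilipschitzWith 2 fun y : S => P (y : Pos d) := by
    refine AntilipschitzWith.of_le_mul_dist fun y y' => ?_
    rw [Subtype.dist_eq, dist_eq_norm, dist_eq_norm, ← map_sub]
    have h1 := hone y' y'.2 y y.2
    have h2 := hone y y.2 y' y'.2
    rw [norm_sub_rev, ← neg_sub, inner_neg_right] at h2
    have h3 := norm_sq_eq_inner_sq_add hn₀ ((y : Pos d) - y')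
    set w : Pos d := (y : Pos d) - y'
    have h4 : ⟪n₀, w⟫ ^ 2 ≤ (1 / 2 * ‖w‖) ^ 2 := sq_le_sq' (by linarith) h1
    refine le_of_sq_le_sq ?_ (by positivity)
    push_cast
    rw [← hP] at h3
    nlinarith [sq_nonneg ‖P w‖]
  have h1 := hanti.le_hausdorffMeasure_image hd univ
  have h2 : μH[(d : ℝ) - 1] S = μH[(d : ℝ) - 1] (univ : Set S) := by
    have := (isometry_subtype_coe (s := S)).hausdorffMeasure_image (Or.inl hd) univ
    rwa [image_univ, Subtype.range_coe] at this
  have := isAddHaarMeasure_hausdorff_hyperplane hn₀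
  have hbdd : Bornology.IsBounded ((fun y : S => P (y : Pos d)) '' univ) := by
    have h3 : Bornology.IsBounded (P '' S) := by
      have hSb : Bornology.IsBounded S :=
        hΩb.closure.subset fun y hy => frontier_subset_closure hy.1
      exact P.lipschitz.isBounded_image hSb
    refine h3.subset ?_
    rintro _ ⟨y, -, rfl⟩
    exact ⟨y, y.2, rfl⟩
  rw [h2]
  refine h1.trans_lt (ENNReal.mul_lt_top ?_ hbdd.measure_lt_top)
  exact ENNReal.rpow_lt_top_of_nonneg hd ENNReal.coe_ne_top

/-- By compactness of the sphere finitely many directions n₀ are within 1/2 of every normal.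
Finiteness is what allows Fubini for the boundary measure. -/
theorem hausdorffMeasure_frontier_lt_top [NeZero d] (hΩo : IsOpen Ω)
    (hΩb : Bornology.IsBounded Ω) (hΩc : Convex ℝ Ω) (hΩs : HasSmoothBoundary Ω) :
    μH[(d : ℝ) - 1] (frontier Ω) < ⊤ := by
  obtain ⟨s, hs, hfin, hcov⟩ := Metric.finite_approx_of_totallyBounded
    (isCompact_sphere (0 : Pos d) 1).totallyBounded (1 / 2) (by norm_num)
  have hsub : frontier Ω ⊆ ⋃ n₀ ∈ s,
      {y ∈ frontier Ω | ∃ n, IsOuterUnitNormal Ω y n ∧ ‖n₀ - n‖ ≤ 1 / 2} := by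
    intro y hy
    obtain ⟨n, hn⟩ := hΩs.exists_normal hy
    have h1 := hcov (show n ∈ Metric.sphere (0 : Pos d) 1 by simpa using hn.norm_eq)
    simp only [mem_iUnion, Metric.mem_ball] at h1 ⊢
    obtain ⟨n₀, hn₀, h2⟩ := h1
    refine ⟨n₀, hn₀, hy, n, hn, ?_⟩
    rw [dist_comm, dist_eq_norm] at h2
    exact h2.le
  exact (measure_mono hsub).trans_lt (measure_biUnion_lt_top hfin fun n₀ hn₀ =>
    hausdorffMeasure_frontier_near_lt_top hΩo hΩb hΩc (by simpa using hs hn₀))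

/-- Almost every line in a given direction avoids a set of vanishing surface measure. -/
theorem ae_line_notMem_of_hausdorff_null [NeZero d] (v : Dir d) {Y : Set (Pos d)}
    (hY : μH[(d : ℝ) - 1] Y = 0) : ∀ᵐ x : Pos d, ∀ r : ℝ, x + r • (v : Pos d) ∉ Y := by
  have hv : ‖(v : Pos d)‖ = 1 := norm_eq_of_mem_sphere v
  have hd : (0 : ℝ) ≤ (d : ℝ) - 1 := by
    have : (1 : ℝ) ≤ d := by exact_mod_cast Nat.one_le_iff_ne_zero.2 (NeZero.ne d)
    linarith
  have := isAddHaarMeasure_hausdorff_hyperplane hv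
  set P := (ℝ ∙ (v : Pos d))ᗮ.orthogonalProjectionOnto with hP
  -- Orthogonal projection along v does not increase Hausdorff measure, and a line in the direction
  -- v meets Y only if its projected point lies in P(Y).
  have h1 : μH[(d : ℝ) - 1] (P '' Y) = 0 :=
    le_antisymm ((hausdorffMeasure_orthogonalProjectionOnto_le _ _ _ hd).trans_eq hY) (zero_le)
  obtain ⟨Z, hsub, hZ, hZ0⟩ := exists_measurable_superset_of_null h1
  have hsurj : Function.Surjective (P : Pos d →ₗ[ℝ] ((ℝ ∙ (v : Pos d))ᗮ : Submodule ℝ (Pos d))) :=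
    fun u => ⟨u, Submodule.orthogonalProjectionOnto_mem_subspace_eq_self u⟩
  have h2 := (ae_comp_linearMap_mem_iff
    (P : Pos d →ₗ[ℝ] ((ℝ ∙ (v : Pos d))ᗮ : Submodule ℝ (Pos d))) (volume : Measure (Pos d))
    (μH[(d : ℝ) - 1]) hsurj hZ.compl).2 (measure_eq_zero_iff_ae_notMem.1 hZ0)
  filter_upwards [h2] with x hx r hr
  refine hx (hsub ⟨x + r • (v : Pos d), hr, ?_⟩)
  have : P (v : Pos d) = 0 := Submodule.orthogonalProjectionOnto_orthogonalComplement_singleton_eq_zero _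
  simp [this]

/-- The time after which the ray from `x` in the direction `v` leaves the convex set `Ω`. -/
def exitTime (Ω : Set (Pos d)) (x : Pos d) (v : Dir d) : ℝ :=
  (volume {r : ℝ | 0 < r ∧ x + r • (v : Pos d) ∈ Ω}).toReal

/-- The exit time is the length of a section of a measurable set; defining it through `volume` makes
measurability a part of Fubini's theorem. -/
theorem measurable_exitTime (hΩ : MeasurableSet Ω) :
    Measurable fun p : Pos d × Dir d => exitTime Ω p.1 p.2 := by
  have hm : MeasurableSet {q : (Pos d × Dir d) × ℝ | 0 < q.2 ∧ q.1.1 + q.2 • (q.1.2 : Pos d) ∈ Ω} := by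
    have h1 : Measurable fun q : (Pos d × Dir d) × ℝ => q.1.1 + q.2 • (q.1.2 : Pos d) := by fun_prop
    exact (measurableSet_lt measurable_const measurable_snd).inter (h1 hΩ)
  exact (measurable_measure_prodMk_left (ν := (volume : Measure ℝ)) hm).ennreal_toReal

/-- By convexity and openness the ray meets Ω in a half-open interval starting at 0, so its length
is its supremum. -/
theorem exitTime_spec (hΩo : IsOpen Ω) (hΩb : Bornology.IsBounded Ω) (hΩc : Convex ℝ Ω)
    {x : Pos d} (hx : x ∈ Ω) (v : Dir d) :
    0 < exitTime Ω x v ∧ exitTime Ω x v ≤ Metric.diam Ω ∧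
      (∀ r, 0 ≤ r → (x + r • (v : Pos d) ∈ Ω ↔ r < exitTime Ω x v)) ∧
      x + exitTime Ω x v • (v : Pos d) ∈ frontier Ω := by
  have hv : ‖(v : Pos d)‖ = 1 := norm_eq_of_mem_sphere v
  have hline : Continuous fun r : ℝ => x + r • (v : Pos d) := by fun_prop
  set E : Set ℝ := (fun r : ℝ => x + r • (v : Pos d)) ⁻¹' Ω with hE
  have hEo : IsOpen E := hΩo.preimage hline
  have h0E : (0 : ℝ) ∈ E := by simpa [hE] using hx
  have hdist : ∀ r ∈ E, r ≤ Metric.diam Ω := by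
    intro r hr
    have h1 := Metric.dist_le_diam_of_mem hΩb hr hx
    simp only [dist_eq_norm, add_sub_cancel_left, norm_smul, hv, mul_one] at h1
    exact (le_abs_self r).trans h1
  have hbdd : BddAbove E := ⟨_, hdist⟩
  have hmid : ∀ r' ∈ E, ∀ r, 0 ≤ r → r ≤ r' → r ∈ E := by
    intro r' hr' r h0 hr
    have hconv : Convex ℝ E := by
      intro a ha b hb α β hα hβ hαβ
      have h1 : x + (α • a + β • b) • (v : Pos d) =
          α • (x + a • (v : Pos d)) + β • (x + b • (v : Pos d)) := by
        obtain rfl : α = 1 - β := by linarith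
        simp only [smul_eq_mul]
        module
      change x + (α • a + β • b) • (v : Pos d) ∈ Ω
      rw [h1]
      exact hΩc ha hb hα hβ hαβ
    exact hconv.ordConnected.out h0E hr' ⟨h0, hr⟩
  have hiff : ∀ r, 0 ≤ r → (r ∈ E ↔ r < sSup E) := by
    intro r hr
    constructor
    · intro hrE
      obtain ⟨ε, hε, hball⟩ := Metric.isOpen_iff.1 hEo r hrE
      have : r + ε / 2 ∈ E := hball (by
        rw [Metric.mem_ball, Real.dist_eq, add_sub_cancel_left, abs_of_pos (by positivity)]; linarith)
      have := le_csSup hbdd this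
      linarith
    · intro hlt
      obtain ⟨r', hr', hrr'⟩ := exists_lt_of_lt_csSup ⟨0, h0E⟩ hlt
      exact hmid r' hr' r hr hrr'.le
  have hpos : 0 < sSup E := (hiff 0 le_rfl).1 h0E
  have hset : {r : ℝ | 0 < r ∧ x + r • (v : Pos d) ∈ Ω} = Ioo 0 (sSup E) := by
    ext r
    exact ⟨fun h => ⟨h.1, (hiff r h.1.le).1 h.2⟩, fun h => ⟨h.1, (hiff r h.1.le).2 h.2⟩⟩
  have hτ : exitTime Ω x v = sSup E := by
    rw [exitTime, hset, Real.volume_Ioo, sub_zero, ENNReal.toReal_ofReal hpos.le]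
  rw [hτ]
  refine ⟨hpos, csSup_le ⟨0, h0E⟩ hdist, hiff, ?_⟩
  rw [hΩo.frontier_eq]
  refine ⟨?_, fun h => lt_irrefl _ ((hiff _ hpos.le).1 h)⟩
  have h1 := (csSup_mem_closure ⟨0, h0E⟩ hbdd)
  exact hline.closure_preimage_subset _ h1

/-- Both sides are the parameter at which the line leaves Ω, whatever interior point it is measured
from. -/
theorem exit_eq_of_line (hΩo : IsOpen Ω) (hΩb : Bornology.IsBounded Ω) (hΩc : Convex ℝ Ω)
    {x : Pos d} {v : Dir d} {r r' : ℝ} (hr : x + r • (v : Pos d) ∈ Ω)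
    (hr' : x + r' • (v : Pos d) ∈ Ω) :
    r + exitTime Ω (x + r • (v : Pos d)) v = r' + exitTime Ω (x + r' • (v : Pos d)) v := by
  have key : ∀ r r' : ℝ, x + r • (v : Pos d) ∈ Ω → x + r' • (v : Pos d) ∈ Ω →
      r + exitTime Ω (x + r • (v : Pos d)) v ≤ r' + exitTime Ω (x + r' • (v : Pos d)) v := by
    intro r r' hr hr'
    by_contra! hlt
    obtain ⟨hpos, -, h1, -⟩ := exitTime_spec hΩo hΩb hΩc hr v
    obtain ⟨hpos', -, h2, -⟩ := exitTime_spec hΩo hΩb hΩc hr' v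
    set τ := exitTime Ω (x + r • (v : Pos d)) v
    set τ' := exitTime Ω (x + r' • (v : Pos d)) v
    rcases le_total 0 (r' + τ' - r) with h | h
    · have h3 := (h1 (r' + τ' - r) h).2 (by linarith)
      have h4 : x + r • (v : Pos d) + (r' + τ' - r) • (v : Pos d) =
        x + r' • (v : Pos d) + τ' • (v : Pos d) := by module
      rw [h4] at h3
      exact lt_irrefl _ ((h2 τ' hpos'.le).1 h3)
    · have h4 : x + r' • (v : Pos d) + (r - r') • (v : Pos d) = x + r • (v : Pos d) := by module
      have h5 := (h2 (r - r') (by linarith)).1 (by rwa [h4])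
      linarith
  exact le_antisymm (key r r' hr hr') (key r' r hr' hr)

/-- For a fixed direction: a property that holds at almost every boundary point and time holds at
the exit point and exit time of almost every interior point. -/
theorem ae_exit_of_ae_frontier [NeZero d] (hΩo : IsOpen Ω) (hΩb : Bornology.IsBounded Ω)
    (hΩc : Convex ℝ Ω) {T : ℝ} (hT : Metric.diam Ω < T) (v : Dir d) {Z : Set (ℝ × Pos d)}
    (hZ : MeasurableSet Z)
    (h : ∀ᵐ y ∂((μH[(d : ℝ) - 1] : Measure (Pos d)).restrict (frontier Ω)),
      ∀ᵐ t ∂((volume : Measure ℝ).restrict (Ioo 0 T)), (t, y) ∉ Z) :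
    ∀ᵐ x : Pos d, ¬ (x ∈ Ω ∧ (exitTime Ω x v, x + exitTime Ω x v • (v : Pos d)) ∈ Z) := by
  set A : Set (Pos d) := {x | x ∈ Ω ∧ (exitTime Ω x v, x + exitTime Ω x v • (v : Pos d)) ∈ Z} with hA
  have hτm : Measurable fun x : Pos d => exitTime Ω x v :=
    (measurable_exitTime hΩo.measurableSet).comp (f := fun x : Pos d => (x, v)) (by fun_prop)
  have hAm : MeasurableSet A := by
    refine hΩo.measurableSet.inter ?_
    have : Measurable fun x : Pos d => (exitTime Ω x v, x + exitTime Ω x v • (v : Pos d)) := by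
      fun_prop
    exact this hZ
  set Y : Set (Pos d) :=
    {y | y ∈ frontier Ω ∧ ¬ ∀ᵐ t ∂((volume : Measure ℝ).restrict (Ioo 0 T)), (t, y) ∉ Z} with hY
  have hY0 : μH[(d : ℝ) - 1] Y = 0 := by
    rw [ae_restrict_iff' isClosed_frontier.measurableSet] at h
    refine measure_mono_null (fun y hy => ?_) h
    simp only [mem_compl_iff, mem_ofPred_eq]
    exact fun hn => hy.2 (hn hy.1)
  -- On a fixed line the exit point x + sv is the same for all starting parameters r, while the exit
  -- time s - r varies with r. Almost every time thus corresponds to almost every starting point.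
  have hline : ∀ᵐ x : Pos d, ∀ᵐ r : ℝ, x + r • (v : Pos d) ∉ A := by
    filter_upwards [ae_line_notMem_of_hausdorff_null v hY0] with x hx
    by_cases hemp : ∃ r₀ : ℝ, x + r₀ • (v : Pos d) ∈ Ω
    swap
    · exact Eventually.of_forall fun r hr => hemp ⟨r, hr.1⟩
    obtain ⟨r₀, hr₀⟩ := hemp
    set s := r₀ + exitTime Ω (x + r₀ • (v : Pos d)) v with hs
    have hexit : ∀ r : ℝ, x + r • (v : Pos d) ∈ Ω →
        exitTime Ω (x + r • (v : Pos d)) v = s - r := fun r hr => by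
      have := exit_eq_of_line hΩo hΩb hΩc hr hr₀
      rw [← hs] at this
      linarith
    have hfr : x + s • (v : Pos d) ∈ frontier Ω := by
      have := (exitTime_spec hΩo hΩb hΩc hr₀ v).2.2.2
      rwa [add_assoc, ← add_smul] at this
    have hgood : ∀ᵐ t ∂((volume : Measure ℝ).restrict (Ioo 0 T)), (t, x + s • (v : Pos d)) ∉ Z := by
      by_contra hn
      exact hx s ⟨hfr, hn⟩
    rw [ae_restrict_iff' measurableSet_Ioo] at hgood
    have hmp : MeasurePreserving (fun r : ℝ => s - r) volume volume :=
      Measure.measurePreserving_sub_left volume s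
    filter_upwards [hmp.quasiMeasurePreserving.ae hgood] with r hr hrA
    have hτ := hexit r hrA.1
    obtain ⟨hpos, hdiam, -, -⟩ := exitTime_spec hΩo hΩb hΩc hrA.1 v
    rw [hτ] at hpos hdiam
    refine hr ⟨hpos, by linarith⟩ ?_
    have h1 := hrA.2
    rw [hτ] at h1
    have h2 : x + r • (v : Pos d) + (s - r) • (v : Pos d) = x + s • (v : Pos d) := by module
    rwa [h2] at h1
  have hm : MeasurableSet {q : Pos d × ℝ | q.1 + q.2 • (v : Pos d) ∉ A} := by
    have : Measurable fun q : Pos d × ℝ => q.1 + q.2 • (v : Pos d) := by fun_prop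
    exact this hAm.compl
  obtain ⟨r, hr⟩ := ((Measure.ae_ae_comm hm).1 hline).exists
  filter_upwards [(measurePreserving_add_right volume
    ((-r) • (v : Pos d))).quasiMeasurePreserving.ae hr] with x hx
  have h2 : x + (-r) • (v : Pos d) + r • (v : Pos d) = x := by module
  rwa [h2] at hx

/-- A property that holds almost everywhere on the outgoing boundary holds at the exit point of
almost every characteristic that starts in `Ω` at time `0`. -/
theorem ae_exit_of_ae_boundary [NeZero d] (hΩo : IsOpen Ω) (hΩb : Bornology.IsBounded Ω)
    (hΩc : Convex ℝ Ω) (hΩs : HasSmoothBoundary Ω) {T : ℝ} (hT : Metric.diam Ω < T)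
    {Q : ℝ × Pos d × Dir d → Prop} (hQ : ∀ᵐ w ∂(boundaryMeasure Ω T), w.2 ∈ outgoing Ω → Q w) :
    ∀ᵐ p ∂(phaseMeasure Ω), Q (exitTime Ω p.1 p.2, p.1 + exitTime Ω p.1 p.2 • (p.2 : Pos d), p.2) := by
  obtain ⟨Z, hsub, hZ, hZ0⟩ := exists_measurable_superset_of_null hQ
  have hfin : IsFiniteMeasure ((μH[(d : ℝ) - 1] : Measure (Pos d)).restrict (frontier Ω)) :=
    ⟨by simpa using hausdorffMeasure_frontier_lt_top hΩo hΩb hΩc hΩs⟩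
  set ν := (μH[(d : ℝ) - 1] : Measure (Pos d)).restrict (frontier Ω) with hν
  set τm := (volume : Measure ℝ).restrict (Ioo 0 T) with hτm
  have h1 : ∀ᵐ w ∂(τm.prod (ν.prod (sphereMeasure d))), w ∉ Z := measure_eq_zero_iff_ae_notMem.1 hZ0
  have h2 : ∀ᵐ q ∂(ν.prod (sphereMeasure d)), ∀ᵐ t ∂τm, (t, q) ∉ Z :=
    Measure.ae_ae_of_ae_prod ((Measure.measurePreserving_swap (μ := ν.prod (sphereMeasure d))
      (ν := τm)).quasiMeasurePreserving.ae h1)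
  have h3 : ∀ᵐ v ∂(sphereMeasure d), ∀ᵐ y ∂ν, ∀ᵐ t ∂τm, (t, y, v) ∉ Z :=
    Measure.ae_ae_of_ae_prod ((Measure.measurePreserving_swap (μ := sphereMeasure d)
      (ν := ν)).quasiMeasurePreserving.ae h2)
  have h4 : ∀ᵐ v ∂(sphereMeasure d), ∀ᵐ x : Pos d,
      ¬ (x ∈ Ω ∧ (exitTime Ω x v, x + exitTime Ω x v • (v : Pos d), v) ∈ Z) := by
    filter_upwards [h3] with v hv
    have hZv : MeasurableSet {q : ℝ × Pos d | (q.1, q.2, v) ∈ Z} := by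
      have : Measurable fun q : ℝ × Pos d => (q.1, q.2, v) := by fun_prop
      exact this hZ
    exact ae_exit_of_ae_frontier hΩo hΩb hΩc hT v hZv hv
  have hτ := measurable_exitTime (d := d) hΩo.measurableSet
  have hm : MeasurableSet {p : Pos d × Dir d |
      ¬ (p.1 ∈ Ω ∧ (exitTime Ω p.1 p.2, p.1 + exitTime Ω p.1 p.2 • (p.2 : Pos d), p.2) ∈ Z)} := by
    refine ((measurable_fst hΩo.measurableSet).inter ?_).compl
    have : Measurable fun p : Pos d × Dir d =>
        (exitTime Ω p.1 p.2, p.1 + exitTime Ω p.1 p.2 • (p.2 : Pos d), p.2) := by fun_prop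
    exact this hZ
  have h5 := (Measure.ae_prod_iff_ae_ae hm).2 ((Measure.ae_ae_comm (μ := (volume : Measure (Pos d)))
    (p := fun x v => ¬ (x ∈ Ω ∧
      (exitTime Ω x v, x + exitTime Ω x v • (v : Pos d), v) ∈ Z)) hm).2 h4)
  rw [ae_phase_iff hΩo.measurableSet]
  filter_upwards [h5] with p hp hpΩ
  by_contra hnQ
  refine hp ⟨hpΩ, hsub fun himp => hnQ (himp ?_)⟩
  obtain ⟨hpos, -, -, hfr⟩ := exitTime_spec hΩo hΩb hΩc hpΩ p.2
  obtain ⟨n, hn⟩ := hΩs.exists_normal hfr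
  refine ⟨hfr, n, hn, ?_⟩
  have h6 := hn.inner_neg hΩo hΩc hfr hpΩ
  have h7 : p.1 - (p.1 + exitTime Ω p.1 p.2 • (p.2 : Pos d)) =
      (-exitTime Ω p.1 p.2) • (p.2 : Pos d) := by module
  rw [h7, real_inner_smul_right] at h6
  change 0 < ⟪n, (p.2 : Pos d)⟫
  nlinarith

end

/-! ### From equal measurements to equal loss terms -/

section

variable {Ω : Set (Pos d)} {L M K C T ρ : ℝ} {g : Pos d → Dir d → ℝ → ℝ}
  {m : Pos d → Dir d → Dir d → ℝ} {h : Pos d → Dir d → ℝ} {f : ℝ → Pos d → Dir d → ℝ}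

theorem IsLoss.mono {L' : ℝ} (hg : IsLoss Ω L g) (hL : L ≤ L') : IsLoss Ω L' g :=
  ⟨hg.measurable, fun x v z z' => (hg.lipschitz x v z z').trans
    (mul_le_mul_of_nonneg_right hL (abs_nonneg _)), hg.zero, hg.outside⟩

theorem rate_zero_kernel (t : ℝ) (x : Pos d) (v : Dir d) :
    rate (fun _ _ _ => 0) g f t x v = -g x v (f t x v) := by
  simp [rate, scattering]

/-- A ballistic solution that takes the value of a stationary solution at one point of a
characteristic that starts in `Ω` coincides with it along this characteristic. -/
theorem IsMild.eq_stationary [NeZero d] (hg : IsLoss Ω L g)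
    (hf : IsMild (fun _ _ _ => 0) g h K C f) {z : ℝ} {B : Pos d → Dir d → ℝ}
    (hB : IsStationary (Ω := Ω) g z B) {x : Pos d} {v : Dir d} {s₀ : ℝ}
    (h0 : f s₀ (x + s₀ • (v : Pos d)) v = B (x + s₀ • (v : Pos d)) v) (s : ℝ) :
    f s (x + s • (v : Pos d)) v = B (x + s • (v : Pos d)) v := by
  have hz : IsKernel Ω 0 (fun (_ : Pos d) (_ _ : Dir d) => (0 : ℝ)) := isKernel_zero le_rfl
  have hal := hf.along hg hz 0 x v
  have hint := hf.intervalIntegrable hg hz 0 x v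
  simp only [zero_add, rate_zero_kernel, intervalIntegral.integral_neg] at hal hint
  refine hB.eq_of_exit_eq hg (y := fun s => f s (x + s • (v : Pos d)) v) (fun a b => ?_)
    (fun s => ?_) h0 s
  · simpa [Pi.neg_def] using (hint a b).neg
  · simp only [zero_smul, add_zero]
    rw [hal s, sub_eq_add_neg]

theorem measurable_indicator_data {B : Pos d → Dir d → ℝ}
    (hB : Measurable fun p : Pos d × Dir d => B p.1 p.2) (hΩ : MeasurableSet Ω) :
    Measurable fun p : Pos d × Dir d => Ω.indicator (fun x => B x p.2) p.1 := by
  have : (fun p : Pos d × Dir d => Ω.indicator (fun x => B x p.2) p.1) =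
      (Prod.fst ⁻¹' Ω).indicator fun p : Pos d × Dir d => B p.1 p.2 := by
    funext p; by_cases hp : p.1 ∈ Ω <;> simp [hp]
  rw [this]
  exact hB.indicator (measurable_fst hΩ)

/-- If the measurements agree, then so do the stationary solutions of the ballistic equations with
the same small exit value. -/
theorem stationary_ae_eq [NeZero d] (hd : 2 ≤ d) (hΩo : IsOpen Ω) (hΩb : Bornology.IsBounded Ω)
    (hΩc : Convex ℝ Ω) (hΩs : HasSmoothBoundary Ω) (hT : Metric.diam Ω < T)
    {μ : Pos d → Dir d → Dir d → ℝ} {σ₁ σ₂ : Pos d → Dir d → ℝ} {N₁ N₂ : Pos d → Dir d → ℝ → ℝ}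
    {δ : ℝ} (hA : SameMeasurements Ω T δ μ σ₁ σ₂ N₁ N₂) (hm : IsKernel Ω M m)
    (hmμ : ∀ᵐ p ∂(phaseMeasure Ω), ∀ᵐ v' ∂(sphereMeasure d), m p.1 v' p.2 = μ p.1 v' p.2)
    {g₁ g₂ : Pos d → Dir d → ℝ → ℝ} (hg₁ : IsLoss Ω L g₁) (hg₂ : IsLoss Ω L g₂)
    (hgN₁ : ∀ᵐ p ∂(phaseMeasure Ω), ∀ z, |z| ≤ ρ → g₁ p.1 p.2 z = σ₁ p.1 p.2 * z + N₁ p.1 p.2 z)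
    (hgN₂ : ∀ᵐ p ∂(phaseMeasure Ω), ∀ z, |z| ≤ ρ → g₂ p.1 p.2 z = σ₂ p.1 p.2 * z + N₂ p.1 p.2 z)
    {z : ℝ} {B₁ B₂ : Pos d → Dir d → ℝ} (hB₁ : IsStationary (Ω := Ω) g₁ z B₁)
    (hB₂ : IsStationary (Ω := Ω) g₂ z B₂) {H : ℝ} (hH0 : 0 ≤ H) (hB₁H : ∀ x ∈ Ω, ∀ v, |B₁ x v| ≤ H)
    (hHδ : H ≤ δ) (hHρ : 6 * H * Real.exp (2 * (M + L + 1) * T) ≤ ρ) :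
    ∀ᵐ p ∂(phaseMeasure Ω), B₁ p.1 p.2 = B₂ p.1 p.2 := by
  have hM := hm.nonneg
  have hL := hg₁.nonneg
  obtain ⟨K, hK⟩ : ∃ K, K = 2 * (M + L + 1) := ⟨_, rfl⟩
  have hK0 : 0 < K := by rw [hK]; positivity
  rw [← hK] at hHρ
  have hexpT : ∀ t ∈ Ioo 0 T, Real.exp (K * |t|) ≤ Real.exp (K * T) := fun t ht => by
    rw [abs_of_pos ht.1]
    exact Real.exp_le_exp.2 (mul_le_mul_of_nonneg_left ht.2.le hK0.le)
  set h : Pos d → Dir d → ℝ := fun x v => Ω.indicator (fun x => B₁ x v) x with hh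
  have hhm : Measurable fun p : Pos d × Dir d => h p.1 p.2 :=
    measurable_indicator_data hB₁.measurable hΩo.measurableSet
  have hhH : ∀ x v, |h x v| ≤ H := by
    intro x v
    by_cases hx : x ∈ Ω
    · simpa [hh, hx] using hB₁H x hx v
    · simpa [hh, hx] using hH0
  -- Giving the zero kernel the bound M keeps the same growth rate K with and without scattering.
  have hz : IsKernel Ω M (fun (_ : Pos d) (_ _ : Dir d) => (0 : ℝ)) := isKernel_zero hM
  obtain ⟨φ₁, hφ₁⟩ := exists_isMild hg₁ hz hK hhm hH0 hhH
  obtain ⟨φ₂, hφ₂⟩ := exists_isMild hg₂ hz hK hhm hH0 hhH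
  have hcap : ∀ (η : ℝ) (V : Set (Dir d)), 0 < η → η ≤ 1 → MeasurableSet V →
      (sphereMeasure d).real V ≤ η → ∀ᵐ p ∂(phaseMeasure Ω), p.2 ∈ V →
        |φ₁ (exitTime Ω p.1 p.2) (p.1 + exitTime Ω p.1 p.2 • (p.2 : Pos d)) p.2 -
          φ₂ (exitTime Ω p.1 p.2) (p.1 + exitTime Ω p.1 p.2 • (p.2 : Pos d)) p.2| ≤
          6 * H * Real.exp (K * T) * η := by
    intro η V hη0 hη1 hV hVη
    obtain ⟨f₁, hf₁, hf₁φ⟩ := exists_isMild_near_ballistic hg₁ hm hK hhm hφ₁ hV hVη (by positivity)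
    obtain ⟨f₂, hf₂, hf₂φ⟩ := exists_isMild_near_ballistic hg₂ hm hK hhm hφ₂ hV hVη (by positivity)
    -- As η ≤ 1, the constant 3H + 3Hη is at most 6H, and the solutions stay where the truncated
    -- loss is the true one.
    have hsmall : ∀ {f : ℝ → Pos d → Dir d → ℝ} {g : Pos d → Dir d → ℝ → ℝ},
        IsMild m g (fun x v => V.indicator (h x) v) K (3 * H + 3 * H * η) f →
        ∀ t ∈ Ioo 0 T, ∀ x v, |f t x v| ≤ ρ := by
      intro f g hf t ht x v
      refine (hf.bound t x v).trans (le_trans ?_ hHρ)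
      refine mul_le_mul ?_ (hexpT t ht) (Real.exp_pos _).le (by positivity)
      nlinarith
    have hVh0 : ∀ x ∉ Ω, ∀ v, V.indicator (h x) v = 0 := by
      intro x hx v
      by_cases hv : v ∈ V <;> simp [hv, hh, hx]
    have hVhm : Measurable fun p : Pos d × Dir d => V.indicator (h p.1) p.2 := by
      have : (fun p : Pos d × Dir d => V.indicator (h p.1) p.2) =
          (Prod.snd ⁻¹' V).indicator fun p : Pos d × Dir d => h p.1 p.2 := by
        funext p; by_cases hv : p.2 ∈ V <;> simp [hv]
      rw [this]
      exact hhm.indicator (measurable_snd hV)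
    have hVhH : ∀ᵐ p ∂(phaseMeasure Ω), ‖V.indicator (h p.1) p.2‖ ≤ H := by
      refine Eventually.of_forall fun p => ?_
      by_cases hv : p.2 ∈ V
      · rw [indicator_of_mem hv]; exact hhH _ _
      · rw [indicator_of_notMem hv, norm_zero]; exact hH0
    have hmeas := hA (fun x v => V.indicator (h x) v)
      (memLp_top_of_bound hVhm.aestronglyMeasurable H hVhH)
      (by
        rw [eLpNorm_exponent_top]
        exact (eLpNormEssSup_le_of_ae_bound hVhH).trans (ENNReal.ofReal_le_ofReal hHδ))
      f₁ f₂ (hf₁.isMeasurement hΩo hΩc hg₁ hm hmμ hgN₁ hVh0 (hsmall hf₁))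
      (hf₂.isMeasurement hΩo hΩc hg₂ hm hmμ hgN₂ hVh0 (hsmall hf₂))
    have hexit := ae_exit_of_ae_boundary hΩo hΩb hΩc hΩs hT
      (Q := fun w => f₁ w.1 w.2.1 w.2.2 = f₂ w.1 w.2.1 w.2.2) hmeas
    filter_upwards [hexit, ae_phase_mem hΩo.measurableSet] with p hp hpΩ hpV
    obtain ⟨hpos, hdiam, -, -⟩ := exitTime_spec hΩo hΩb hΩc hpΩ p.2
    set τ := exitTime Ω p.1 p.2
    have hτ : τ ∈ Ioo 0 T := ⟨hpos, by linarith⟩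
    have h1 := hf₁φ τ (p.1 + τ • (p.2 : Pos d)) p.2
    have h2 := hf₂φ τ (p.1 + τ • (p.2 : Pos d)) p.2
    rw [indicator_of_mem hpV] at h1 h2
    rw [hp] at h1
    have h3 : 3 * H * η * Real.exp (K * |τ|) ≤ 3 * H * η * Real.exp (K * T) :=
      mul_le_mul_of_nonneg_left (hexpT τ hτ) (by positivity)
    rw [abs_sub_comm] at h1
    calc _ ≤ _ := abs_sub_le _ (f₂ τ (p.1 + τ • (p.2 : Pos d)) p.2) _
      _ ≤ 3 * H * η * Real.exp (K * T) + 3 * H * η * Real.exp (K * T) :=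
        add_le_add (h1.trans h3) (h2.trans h3)
      _ = _ := by ring
  have hall : ∀ᵐ p ∂(phaseMeasure Ω), ∀ n : ℕ,
        |φ₁ (exitTime Ω p.1 p.2) (p.1 + exitTime Ω p.1 p.2 • (p.2 : Pos d)) p.2 -
          φ₂ (exitTime Ω p.1 p.2) (p.1 + exitTime Ω p.1 p.2 • (p.2 : Pos d)) p.2| ≤
          6 * H * Real.exp (K * T) * (1 / ((n : ℝ) + 1)) := by
    refine ae_all_iff.2 fun n => ?_
    have hn : (0 : ℝ) < 1 / ((n : ℝ) + 1) := Nat.one_div_pos_of_nat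
    obtain ⟨V, hV, hVη, hcov⟩ := exists_small_cover hd hn
    have h1 := ae_all_iff.2 fun i => hcap _ (V i) hn
      (by rw [div_le_one (by positivity)]; linarith [(Nat.cast_nonneg n : (0 : ℝ) ≤ n)]) (hV i) (hVη i)
    filter_upwards [h1] with p hp
    obtain ⟨i, hi⟩ := hcov p.2
    exact hp i hi
  filter_upwards [hall, ae_phase_mem hΩo.measurableSet] with p hp hpΩ
  obtain ⟨x, v⟩ := p
  simp only at hp hpΩ ⊢
  obtain ⟨hpos, -, hin, -⟩ := exitTime_spec hΩo hΩb hΩc hpΩ v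
  set τ := exitTime Ω x v
  have heq : φ₁ τ (x + τ • (v : Pos d)) v = φ₂ τ (x + τ • (v : Pos d)) v := by
    have hlim : Tendsto (fun n : ℕ => 6 * H * Real.exp (K * T) * (1 / ((n : ℝ) + 1))) atTop (𝓝 0) := by
      simpa using tendsto_one_div_add_atTop_nhds_zero_nat.const_mul (6 * H * Real.exp (K * T))
    have := ge_of_tendsto' hlim hp
    exact sub_eq_zero.1 (abs_nonpos_iff.1 this)
  have hout : ∀ r : ℝ, 0 < r → x + τ • (v : Pos d) + r • (v : Pos d) ∉ Ω := by
    intro r hr hmem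
    rw [add_assoc, ← add_smul] at hmem
    have := (hin (τ + r) (by linarith)).1 hmem
    linarith
  have hhx : h x v = B₁ x v := by simp [hh, hpΩ]
  have h1 := hφ₁.eq_stationary hg₁ hB₁ (x := x) (v := v) (s₀ := 0)
    (by simp [hφ₁.initial, hhx]) τ
  -- The first ballistic solution, started on B₁, leaves with the value z; so does the second, which
  -- therefore meets B₂ at the exit. Running the ODE back to time 0 yields B₁ = B₂.
  rw [hB₁.exit _ _ hout, heq, ← hB₂.exit _ _ hout] at h1
  have h2 := hφ₂.eq_stationary hg₂ hB₂ h1 0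
  simp only [zero_smul, add_zero, hφ₂.initial, hhx] at h2
  exact h2

/-- Lebesgue differentiation: almost everywhere e is the derivative of U, which is locally constant
on E. -/
theorem ae_eq_zero_of_integral_locally_zero {e U : ℝ → ℝ} {E : Set ℝ} (hE : IsOpen E)
    (he : ∀ a b, IntervalIntegrable e volume a b) (hU : ∀ s, U s = U 0 + ∫ r in (0 : ℝ)..s, e r)
    (hUE : ∀ r ∈ E, U r = 0) : ∀ᵐ r, r ∈ E → e r = 0 := by
  have hloc : LocallyIntegrable e volume := fun x =>
    ⟨Ioc (x - 1) (x + 1), Ioc_mem_nhds (by linarith) (by linarith), (he _ _).1⟩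
  filter_upwards [LocallyIntegrable.ae_hasDerivAt_integral hloc] with r hr hrE
  have h1 : HasDerivAt U (e r) r := by
    rw [show U = _ from funext hU]
    exact (hr 0).const_add _
  have h2 : U =ᶠ[𝓝 r] fun _ => 0 := by
    filter_upwards [hE.mem_nhds hrE] with s hs using hUE s hs
  exact h1.unique ((hasDerivAt_const r (0 : ℝ)).congr_of_eventuallyEq h2)

/-- Where stationary solutions of two ballistic equations agree, so do the loss terms at their
values. -/
theorem loss_ae_eq_of_stationary_ae_eq [NeZero d] (hΩo : IsOpen Ω) {g₁ g₂ : Pos d → Dir d → ℝ → ℝ}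
    (hg₁ : IsLoss Ω L g₁) (hg₂ : IsLoss Ω L g₂) {z : ℝ} {B₁ B₂ : Pos d → Dir d → ℝ}
    (hB₁ : IsStationary (Ω := Ω) g₁ z B₁) (hB₂ : IsStationary (Ω := Ω) g₂ z B₂)
    (hB : ∀ᵐ p ∂(phaseMeasure Ω), B₁ p.1 p.2 = B₂ p.1 p.2) :
    ∀ᵐ p ∂(phaseMeasure Ω), g₁ p.1 p.2 (B₁ p.1 p.2) = g₂ p.1 p.2 (B₁ p.1 p.2) := by
  rw [ae_phase_iff hΩo.measurableSet] at hB ⊢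
  have hline := ae_line_of_ae (P := fun x v => x ∈ Ω → B₁ x v = B₂ x v) hB
  have hgm₁ : Measurable fun p : Pos d × Dir d => g₁ p.1 p.2 (B₁ p.1 p.2) :=
    hg₁.measurable.comp (f := fun p : Pos d × Dir d => (p, B₁ p.1 p.2))
      (measurable_id.prodMk hB₁.measurable)
  have hgm₂ : Measurable fun p : Pos d × Dir d => g₂ p.1 p.2 (B₁ p.1 p.2) :=
    hg₂.measurable.comp (f := fun p : Pos d × Dir d => (p, B₁ p.1 p.2))
      (measurable_id.prodMk hB₁.measurable)
  refine ae_of_ae_line (P := fun x v => x ∈ Ω → g₁ x v (B₁ x v) = g₂ x v (B₁ x v)) ?_ ?_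
  · have : {p : Pos d × Dir d | p.1 ∈ Ω → g₁ p.1 p.2 (B₁ p.1 p.2) = g₂ p.1 p.2 (B₁ p.1 p.2)} =
        (Prod.fst ⁻¹' Ω)ᶜ ∪ {p | g₁ p.1 p.2 (B₁ p.1 p.2) = g₂ p.1 p.2 (B₁ p.1 p.2)} := by
      ext p
      exact imp_iff_not_or
    rw [this]
    exact (measurable_fst hΩo.measurableSet).compl.union (measurableSet_eq_fun hgm₁ hgm₂)
  filter_upwards [hline] with p hp
  obtain ⟨x, v⟩ := p
  simp only at hp ⊢
  set E : Set ℝ := {r | x + r • (v : Pos d) ∈ Ω} with hE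
  have hEo : IsOpen E := hΩo.preimage (by fun_prop : Continuous fun r : ℝ => x + r • (v : Pos d))
  -- Continuity along the line upgrades almost everywhere equality on the open set E to equality
  -- everywhere on E, as needed for differentiation.
  have hEq : EqOn (fun r : ℝ => B₁ (x + r • (v : Pos d)) v) (fun r : ℝ => B₂ (x + r • (v : Pos d)) v)
      E :=
    Measure.eqOn_open_of_ae_eq (μ := volume) ((ae_restrict_iff' hEo.measurableSet).2 hp) hEo
      (hB₁.continuous_along x v).continuousOn (hB₂.continuous_along x v).continuousOn
  have hi₁ := hB₁.intervalIntegrable x v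
  have hi₂ := hB₂.intervalIntegrable x v
  have key := ae_eq_zero_of_integral_locally_zero hEo
    (U := fun r => B₁ (x + r • (v : Pos d)) v - B₂ (x + r • (v : Pos d)) v)
    (e := fun r => g₂ (x + r • (v : Pos d)) v (B₂ (x + r • (v : Pos d)) v) -
      g₁ (x + r • (v : Pos d)) v (B₁ (x + r • (v : Pos d)) v))
    (fun a b => (hi₂ a b).sub (hi₁ a b))
    (fun s => by
      rw [hB₁.along x v s, hB₂.along x v s, intervalIntegral.integral_sub (hi₂ _ _) (hi₁ _ _)]
      simp only [zero_smul, add_zero]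
      ring)
    (fun r hr => sub_eq_zero.2 (hEq hr))
  filter_upwards [key] with r hr hrE
  have h1 := sub_eq_zero.1 (hr hrE)
  have h2 := hEq hrE
  simp only at h2
  rw [← h1, h2]

theorem analyticAt_of_hasSum {F : ℝ → ℝ} {a : ℕ → ℝ} {z₀ r : ℝ} (hr : 0 < r)
    (h : ∀ z, |z - z₀| < r → HasSum (fun k => a k * (z - z₀) ^ k) (F z)) {z : ℝ}
    (hz : |z - z₀| < r) : AnalyticAt ℝ F z := by
  set p := FormalMultilinearSeries.ofScalars ℝ a with hp
  have hball : HasFPowerSeriesOnBall F p z₀ (ENNReal.ofReal r) := by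
    refine ⟨?_, ENNReal.ofReal_pos.2 hr, ?_⟩
    · refine ENNReal.le_of_forall_nnreal_lt fun s hs => ?_
      have hs' : (s : ℝ) < r := by
        rw [← ENNReal.ofReal_coe_nnreal] at hs
        exact (ENNReal.ofReal_lt_ofReal_iff hr).1 hs
      refine p.le_radius_of_summable_norm ?_
      have h1 := (h (z₀ + s) (by simpa using hs')).summable.abs
      refine h1.congr fun k => ?_
      simp [hp, abs_mul]
    · intro y hy
      have hy' : |y| < r := by
        rw [Metric.mem_eball, edist_zero_right, ← ofReal_norm,
          ENNReal.ofReal_lt_ofReal_iff hr] at hy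
        simpa using hy
      have h1 := h (z₀ + y) (by simpa using hy')
      simp only [add_sub_cancel_left] at h1
      have h2 : (fun k => p k fun _ => y) = fun k => a k * y ^ k := by
        funext k
        rw [FormalMultilinearSeries.apply_eq_pow_smul_coeff, hp,
          FormalMultilinearSeries.coeff_ofScalars, smul_eq_mul, mul_comm]
      rw [h2]
      exact h1
  refine hball.analyticOnNhd z ?_
  rw [Metric.mem_eball, edist_dist, Real.dist_eq]
  exact (ENNReal.ofReal_lt_ofReal_iff hr).2 hz

/-- Countably many discs of convergence cover the real line, so one null set of (x,v) serves for all
z. -/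
theorem IsLinftyAnalytic.ae_analytic {N : Pos d → Dir d → ℝ → ℝ} (hN : IsLinftyAnalytic Ω N) :
    ∀ᵐ p ∂(phaseMeasure Ω), AnalyticOnNhd ℝ (N p.1 p.2) univ := by
  choose r hr a _ _ hsum using hN
  obtain ⟨s, hs, hsU⟩ := TopologicalSpace.countable_cover_nhds
    (f := fun z₀ => Metric.ball z₀ (r z₀)) fun z₀ => Metric.ball_mem_nhds z₀ (hr z₀)
  filter_upwards [(ae_ball_iff hs).2 fun z₀ _ => hsum z₀] with p hp z hz
  rw [← hsU, mem_iUnion₂] at hz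
  obtain ⟨z₀, hz₀, hzb⟩ := hz
  exact analyticAt_of_hasSum (hr z₀) (hp z₀ hz₀) hzb

end

end Transport

end

/-! ### Conclusion by the identity theorem -/

theorem theorem1p1 {d : ℕ} (hd : 2 ≤ d) (Ω : Set (Transport.Pos d))
    (hΩo : IsOpen Ω) (hΩb : Bornology.IsBounded Ω) (hΩc : Convex ℝ Ω)
    (hΩs : Transport.HasSmoothBoundary Ω)
    (T : ℝ) (hT : Metric.diam Ω < T)
    (γ : Transport.Dir d) (γ₀ : ℝ) (hγ₀ : 0 < γ₀)
    (μ : Transport.Pos d → Transport.Dir d → Transport.Dir d → ℝ)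
    (σ₁ σ₂ : Transport.Pos d → Transport.Dir d → ℝ)
    (N₁ N₂ : Transport.Pos d → Transport.Dir d → ℝ → ℝ)
    (hσ₁ : Transport.IsAdmissible Ω σ₁ μ) (hσ₂ : Transport.IsAdmissible Ω σ₂ μ)
    (hN₁ : Transport.IsNonlinearity Ω N₁) (hN₂ : Transport.IsNonlinearity Ω N₂)
    (hΛσ₁ : Transport.InLambda Ω γ γ₀ σ₁) (hΛσ₂ : Transport.InLambda Ω γ γ₀ σ₂)
    (hΛμ : ∀ᵐ v ∂(Transport.sphereMeasure d),
      Transport.InLambda Ω γ γ₀ (fun x v' => μ x v' v))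
    (hΛq₁ : ∀ k : ℕ, 2 ≤ k → Transport.InLambda Ω γ γ₀ (Transport.taylorCoeff N₁ k))
    (hΛq₂ : ∀ k : ℕ, 2 ≤ k → Transport.InLambda Ω γ γ₀ (Transport.taylorCoeff N₂ k))
    (δ : ℝ) (hδ : 0 < δ)
    (hA : Transport.SameMeasurements Ω T δ μ σ₁ σ₂ N₁ N₂) :
    (∀ᵐ p ∂(Transport.phaseMeasure Ω), σ₁ p.1 p.2 = σ₂ p.1 p.2) ∧
    (∀ᵐ p ∂(Transport.phaseMeasure Ω), ∀ z : ℝ, N₁ p.1 p.2 z = N₂ p.1 p.2 z) := by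
  open Transport in
  have : NeZero d := ⟨by omega⟩
  have hΩm := hΩo.measurableSet
  obtain ⟨M, m, hm, hmμ⟩ := exists_kernel_rep hΩm hσ₁.memLp_scattering
  obtain ⟨L₁, ρ₁, g₁, hρ₁, hg₁, hgN₁⟩ := exists_loss_rep hΩm hσ₁.memLp_absorption hN₁
  obtain ⟨L₂, ρ₂, g₂, hρ₂, hg₂, hgN₂⟩ := exists_loss_rep hΩm hσ₂.memLp_absorption hN₂
  obtain ⟨R, hR⟩ := hΩb.exists_norm_le
  set L := max L₁ L₂
  set ρ := min ρ₁ ρ₂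
  have hρ : 0 < ρ := lt_min hρ₁ hρ₂
  replace hg₁ := hg₁.mono (le_max_left L₁ L₂)
  replace hg₂ := hg₂.mono (le_max_right L₁ L₂)
  have hgN₁' : ∀ᵐ p ∂(phaseMeasure Ω), ∀ z, |z| ≤ ρ →
      g₁ p.1 p.2 z = σ₁ p.1 p.2 * z + N₁ p.1 p.2 z := by
    filter_upwards [hgN₁] with p hp z hz using hp z (hz.trans (min_le_left _ _))
  have hgN₂' : ∀ᵐ p ∂(phaseMeasure Ω), ∀ z, |z| ≤ ρ →
      g₂ p.1 p.2 z = σ₂ p.1 p.2 * z + N₂ p.1 p.2 z := by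
    filter_upwards [hgN₂] with p hp z hz using hp z (hz.trans (min_le_right _ _))
  set c := 1 + 2 * Real.exp (4 * (L + 1) * R) with hc
  have hc0 : 0 < c := by positivity
  set D := 6 * Real.exp (2 * (M + L + 1) * T) with hD
  have hD0 : 0 < D := by positivity
  -- Here c is the bound of a stationary solution per unit of exit value. The three terms ensure
  -- that the data have norm at most δ, that the values of B₁ lie in the untruncated range, and that
  -- the solutions with scattering stay in that range up to time T.
  set z₀ := min (δ / c) (min (ρ / c) (ρ / (c * D))) with hz₀
  have hz₀pos : 0 < z₀ := by positivity
  have hcz₁ : c * z₀ ≤ δ := by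
    rw [mul_comm, ← le_div_iff₀ hc0]; exact min_le_left _ _
  have hcz₂ : c * z₀ ≤ ρ := by
    rw [mul_comm, ← le_div_iff₀ hc0]; exact (min_le_right _ _).trans (min_le_left _ _)
  have hcz₃ : c * z₀ * D ≤ ρ := by
    rw [mul_right_comm, mul_comm, ← le_div_iff₀ (by positivity)]
    exact (min_le_right _ _).trans (min_le_right _ _)
  set w : ℕ → ℝ := fun n => z₀ * (1 / ((n : ℝ) + 1)) with hw
  have hwpos : ∀ n, 0 < w n := fun n => by positivity
  have hwle : ∀ n, w n ≤ z₀ := fun n => by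
    refine mul_le_of_le_one_right hz₀pos.le ?_
    rw [div_le_one (by positivity)]
    linarith [(Nat.cast_nonneg n : (0 : ℝ) ≤ n)]
  have hwlim : Tendsto w atTop (𝓝 0) := by
    simpa [hw] using tendsto_one_div_add_atTop_nhds_zero_nat.const_mul z₀
  choose B₁ hB₁ hB₁b using fun n => exists_isStationary hg₁ hR (w n)
  choose B₂ hB₂ _ using fun n => exists_isStationary hg₂ hR (w n)
  have hloss : ∀ᵐ p ∂(phaseMeasure Ω), ∀ n,
      g₁ p.1 p.2 (B₁ n p.1 p.2) = g₂ p.1 p.2 (B₁ n p.1 p.2) := by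
    refine ae_all_iff.2 fun n => loss_ae_eq_of_stationary_ae_eq hΩo hg₁ hg₂ (hB₁ n) (hB₂ n) ?_
    have hcw : c * |w n| ≤ c * z₀ := by
      rw [abs_of_pos (hwpos n)]
      exact mul_le_mul_of_nonneg_left (hwle n) hc0.le
    refine stationary_ae_eq hd hΩo hΩb hΩc hΩs hT hA hm hmμ hg₁ hg₂ hgN₁' hgN₂' (hB₁ n) (hB₂ n)
      (H := c * |w n|) (by positivity) (hB₁b n) (hcw.trans hcz₁) ?_
    calc 6 * (c * |w n|) * Real.exp (2 * (M + L + 1) * T) = c * |w n| * D := by rw [hD]; ring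
      _ ≤ c * z₀ * D := mul_le_mul_of_nonneg_right hcw hD0.le
      _ ≤ ρ := hcz₃
  have hmain : ∀ᵐ p ∂(phaseMeasure Ω),
      σ₁ p.1 p.2 = σ₂ p.1 p.2 ∧ ∀ z : ℝ, N₁ p.1 p.2 z = N₂ p.1 p.2 z := by
    filter_upwards [hloss, hgN₁', hgN₂', ae_phase_mem hΩm, hN₁.analytic.ae_analytic,
      hN₂.analytic.ae_analytic, hN₁.deriv_zero, hN₂.deriv_zero]
      with p hp h1 h2 hpΩ han₁ han₂ hd₁ hd₂
    have hlin : ∀ s : ℝ, AnalyticOnNhd ℝ (fun z => s * z) univ := fun s =>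
      analyticOnNhd_const.mul analyticOnNhd_id
    have heq : (fun z => σ₁ p.1 p.2 * z + N₁ p.1 p.2 z) =
        fun z => σ₂ p.1 p.2 * z + N₂ p.1 p.2 z := by
      refine AnalyticOnNhd.eq_of_frequently_eq (z₀ := 0) ((hlin _).add han₁) ((hlin _).add han₂) ?_
      have hbound : ∀ n, |B₁ n p.1 p.2| ≤ c * w n := fun n => by
        have := hB₁b n p.1 hpΩ p.2
        rwa [abs_of_pos (hwpos n)] at this
      -- The identity theorem needs points other than 0 accumulating at 0: the values are O(w n),
      -- and they never vanish because a zero would propagate to the exit.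
      have hlim : Tendsto (fun n => B₁ n p.1 p.2) atTop (𝓝[≠] 0) := by
        refine tendsto_nhdsWithin_iff.2 ⟨?_, Eventually.of_forall fun n => ?_⟩
        · exact squeeze_zero_norm hbound (by simpa using hwlim.const_mul c)
        · refine (hB₁ n).ne_zero hg₁ (hwpos n).ne' (τ := exitTime Ω p.1 p.2) fun r hr hmem => ?_
          obtain ⟨hpos, -, hin, -⟩ := exitTime_spec hΩo hΩb hΩc hpΩ p.2
          exact absurd ((hin r (by linarith)).1 hmem) (by linarith)
      refine hlim.frequently (Frequently.of_forall fun n => ?_)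
      have hle : |B₁ n p.1 p.2| ≤ ρ :=
        (hbound n).trans ((mul_le_mul_of_nonneg_left (hwle n) hc0.le).trans hcz₂)
      rw [← h1 _ hle, ← h2 _ hle, hp n]
    -- Since N has zero derivative at 0, the linear coefficient of the total loss is σ, which
    -- separates σ from N.
    have hder : ∀ (s : ℝ) (F : ℝ → ℝ), AnalyticOnNhd ℝ F univ → deriv F 0 = 0 →
        deriv (fun z => s * z + F z) 0 = s := by
      intro s F hF hF0
      have h3 := ((hasDerivAt_id (0 : ℝ)).const_mul s).add
        (hF 0 (mem_univ 0)).differentiableAt.hasDerivAt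
      rw [hF0, add_zero, mul_one] at h3
      exact h3.deriv
    have hσ : σ₁ p.1 p.2 = σ₂ p.1 p.2 := by
      rw [← hder (σ₁ p.1 p.2) _ han₁ hd₁, heq, hder _ _ han₂ hd₂]
    refine ⟨hσ, fun z => ?_⟩
    have h4 := congrFun heq z
    simp only [hσ] at h4
    exact add_left_cancel h4
  exact ⟨hmain.mono fun p hp => hp.1, hmain.mono fun p hp => hp.2⟩
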